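/- **Model.** There are $K\ge 1$ types of resources, each with capacity $1$ and supply cost $f(y)=ay^s$, where $a>0$ and $s>1$. A finite set $\mathcal B\subset[0,\infty)^K$ of bundles $b=(r_1^b,\dots,r_K^b)$ contains the empty bundle $\emptyset=0$. Customers $n=1,\dots,N$ arrive one by one; customer $n$ has a valuation function $v_n:\mathcal B\to\mathbb R$ with $v_n(\emptyset)=0$ and $v_n(b)/r_k^b\le\overline p$ whenever $r_k^b\ne0$, where $\overline p>0$ is given. A (deterministic) online algorithm assigns to each customer on arrival, irrevocably, one bundle $b_n\in\mathcal B$, knowing only $f,\overline p,\mathcal B$ and $v_1,\dots,v_n$, such that the total consumption $y_k=\sum_n r_k^{b_n}$ never exceeds $1$. Its social welfare on an instance $\mathcal A$ is $W_{\rm online}(\mathcal A)=\sum_n v_n(b_n)-\sum_k f(y_k)$, and $W_{\rm opt}(\mathcal A)$ is the maximum of the same quantity over all assignments of bundles to customers with $y_k\le1$ for all $k$. For $\alpha\ge1$ and $\delta\geq 0$ call an online algorithm $(\alpha,\delta)$-competitive if $W_{\rm online}(\mathcal A)\ge\frac1\alpha W_{\rm opt}(\mathcal A)-\delta$ for all instances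 $\mathcal A$. We say that $\alpha\ge 1$ is the *optimal competitive ratio* (for infinitesimally small bundles) if 1. for every $\delta>0$ there is $\varepsilon>0$ such that for every $\mathcal B$ with all $r_k^b\le\varepsilon$ there is an $(\alpha,\delta)$-competitive online algorithm; and 2. for every $1\le\beta<\alpha$ there are $\delta>0$ and $\varepsilon>0$ such that for no $\mathcal B$ with all $r_k^b\le\varepsilon$ that contains a bundle with exactly one nonzero entry there is a $(\beta,\delta)$-competitive online algorithm. **Notation.** Let $\overline c=f'(1)=as$, $\alpha_s^{\min}=s^{\frac{s}{s-1}}$, $u_s=(1/s)^{\frac1{s-1}}$, $\alpha_s(u)=\frac{s-1}{u-u^s}$, and $$C_s=\overline c\,\Big(e^{-s}-s^{-s}\int_s^{\alpha_s^{\min}}\eta^{s-1}e^{-\eta}\,d\eta\Big)e^{\alpha_s^{\min}}.$$ Let $\underline\alpha_1(u)=\alpha_s(u)$ for $u\in(0,u_s)$ and $\underline\alpha_1(u)=\alpha_s^{\min}$ for $u\in[u_s,1)$. A critical dividing threshold is a $u\in(0,1)$ such that $\alpha=\underline\alpha_1(u)$ is a positive solution of $$\int_{u\alpha}^{\alpha}\eta^{s-1}e^{-\eta}\,d\eta=\frac{\alpha^{s-1}}{e^{u\alpha}}-\frac{\overline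 p\,\alpha^{s-1}}{\overline c\,e^{\alpha}}.$$ **Result.** If $\overline p\in(0,\overline c]$ (low uncertainty) or $\overline p\in(\overline c,C_s]$ (first high-uncertainty case), the optimal competitive ratio is $s^{\frac{s}{s-1}}$. If $\overline p>C_s$ (second high-uncertainty case), there is exactly one critical dividing threshold $u_{\mathsf{cdt}}$, it lies in $(0,u_s)$, and the optimal competitive ratio is $$\frac{s-1}{u_{\mathsf{cdt}}-u_{\mathsf{cdt}}^{\,s}}.$$ -/

import Mathlib

/-! ### Online resource allocation with supply costs and unit capacities -/

/-- A bundle of `K` types of resources: `b k` is the number of units of resource `k`, as a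
proportion of the (unit) capacity. The zero vector is the empty bundle. -/
abbrev Bundle (K : ℕ) : Type := Fin K → ℝ

/-- `B` is a set of bundles that contains the empty bundle, has nonnegative entries, and in which
no bundle uses more than `ε` units of any resource. -/
structure IsBundleSet {K : ℕ} (B : Finset (Bundle K)) (ε : ℝ) : Prop where
  empty_mem : (0 : Bundle K) ∈ B
  nonneg : ∀ b ∈ B, ∀ k, 0 ≤ b k
  small : ∀ b ∈ B, ∀ k, b k ≤ ε

/-- Some bundle in `B` uses exactly one type of resource. -/
def HasSingleResourceBundle {K : ℕ} (B : Finset (Bundle K)) : Prop :=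
  ∃ b ∈ B, ∃ k, 0 < b k ∧ ∀ j, j ≠ k → b j = 0

/-- A valuation function on the bundles in `B`. -/
abbrev BundleValuation {K : ℕ} (B : Finset (Bundle K)) : Type := {b : Bundle K // b ∈ B} → ℝ

/-- The empty bundle has value zero, and every per-unit-valuation is at most `pbar`. Nothing else
is assumed about a valuation function. -/
def BundleValuation.Admissible {K : ℕ} {B : Finset (Bundle K)} (pbar : ℝ) (v : BundleValuation B) : Prop :=
  (∀ b : {b : Bundle K // b ∈ B}, b.1 = 0 → v b = 0) ∧
    ∀ (b : {b : Bundle K // b ∈ B}) (k : Fin K), b.1 k ≠ 0 → v b / b.1 k ≤ pbar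

/-- An arrival instance: the valuation functions of the customers in the order of arrival. -/
abbrev ArrivalInstance {K : ℕ} (B : Finset (Bundle K)) : Type := List (BundleValuation B)

/-- Every customer of the instance has an admissible valuation function. -/
def ArrivalInstance.Admissible {K : ℕ} {B : Finset (Bundle K)} (pbar : ℝ)
    (A : ArrivalInstance B) : Prop :=
  ∀ v ∈ A, BundleValuation.Admissible pbar v

/-- An integral allocation gives each customer exactly one bundle (possibly the empty one). -/
abbrev Allocation {K : ℕ} {B : Finset (Bundle K)} (A : ArrivalInstance B) : Type :=
  Fin A.length → {b : Bundle K // b ∈ B}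

/-- Total consumption `y_k` of resource `k`. -/
def utilization {K : ℕ} {B : Finset (Bundle K)} {A : ArrivalInstance B} (x : Allocation A)
    (k : Fin K) : ℝ :=
  ∑ n, (x n).1 k

/-- The capacity constraints `0 ≤ y_k ≤ 1`. -/
def Allocation.Feasible {K : ℕ} {B : Finset (Bundle K)} {A : ArrivalInstance B}
    (x : Allocation A) : Prop :=
  ∀ k, 0 ≤ utilization x k ∧ utilization x k ≤ 1

/-- Social welfare: total valuation minus total supply cost. -/
def welfare {K : ℕ} {B : Finset (Bundle K)} (f : ℝ → ℝ) (A : ArrivalInstance B)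
    (x : Allocation A) : ℝ :=
  ∑ n, A.get n (x n) - ∑ k, f (utilization x k)

/-- The offline optimum: the maximum of the welfare over the (finitely many) feasible
allocations. -/
noncomputable def optWelfare {K : ℕ} {B : Finset (Bundle K)} (f : ℝ → ℝ)
    (A : ArrivalInstance B) : ℝ :=
  sSup {w : ℝ | ∃ x : Allocation A, Allocation.Feasible x ∧ w = welfare f A x}

/-- A rule that gives a bundle to each customer, upon her arrival and irrevocably, on the basis of
the earlier valuation functions (first argument) and hers (second argument). -/
abbrev OnlineRule {K : ℕ} (B : Finset (Bundle K)) : Type :=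
  List (BundleValuation B) → BundleValuation B → {b : Bundle K // b ∈ B}

/-- The allocation produced by an online rule on an arrival instance. -/
def OnlineRule.run {K : ℕ} {B : Finset (Bundle K)} (alg : OnlineRule B) (A : ArrivalInstance B) :
    Allocation A :=
  fun n => alg (A.take n) (A.get n)

/-- An online algorithm is an online rule that respects the capacities on all admissible
instances. -/
def OnlineRule.IsAlgorithm {K : ℕ} {B : Finset (Bundle K)} (pbar : ℝ) (alg : OnlineRule B) :
    Prop :=
  ∀ A : ArrivalInstance B, ArrivalInstance.Admissible pbar A →
    Allocation.Feasible (OnlineRule.run alg A)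

/-- `W_online(A) ≥ W_opt(A) / α - δ` for all admissible arrival instances `A`. -/
def OnlineRule.CompetitiveUpTo {K : ℕ} {B : Finset (Bundle K)} (f : ℝ → ℝ) (pbar α δ : ℝ)
    (alg : OnlineRule B) : Prop :=
  ∀ A : ArrivalInstance B, ArrivalInstance.Admissible pbar A →
    (1 / α) * optWelfare f A - δ ≤ welfare f A (OnlineRule.run alg A)

/-- Some online algorithm for the bundle set `B` is `α`-competitive up to the additive error
`δ`. -/
def Achievable {K : ℕ} (f : ℝ → ℝ) (pbar : ℝ) (B : Finset (Bundle K)) (α δ : ℝ) : Prop :=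
  ∃ alg : OnlineRule B, OnlineRule.IsAlgorithm pbar alg ∧ OnlineRule.CompetitiveUpTo f pbar α δ alg

/-- `α` is the optimal competitive ratio, over all online algorithms, for `K` types of resources
with cost function `f` and upper bound `pbar` on the per-unit-valuations, in the regime of
infinitesimally small bundles: the ratio `α` is achieved up to an additive error that vanishes with
the bundle size, and no smaller ratio is. For a positive bundle size an additive error cannot be
avoided: if `r` is the only size and `K = 1`, then an algorithm with a finite ratio and `δ = 0` has
to sell to a first customer of value slightly above `f r`, which ruins its ratio if a second
customer of value `f (2 * r) - f r` follows. -/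
structure IsOptimalCompetitiveRatio (K : ℕ) (f : ℝ → ℝ) (pbar α : ℝ) : Prop where
  one_le : 1 ≤ α
  achieved : ∀ δ : ℝ, 0 < δ → ∃ ε : ℝ, 0 < ε ∧
    ∀ B : Finset (Bundle K), IsBundleSet B ε → Achievable f pbar B α δ
  optimal : ∀ β : ℝ, 1 ≤ β → β < α → ∃ δ : ℝ, 0 < δ ∧ ∃ ε : ℝ, 0 < ε ∧
    ∀ B : Finset (Bundle K), IsBundleSet B ε → HasSingleResourceBundle B →
      ¬ Achievable f pbar B β δ

/-! ### Power cost functions -/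

/-- The power cost function `f(y) = a y^s`. -/
noncomputable def powerCost (a s : ℝ) (y : ℝ) : ℝ := a * y ^ s

/-- The maximum marginal cost `f'(1) = a s`. (The minimum marginal cost `f'(0)` is `0`.) -/
def cBar (a s : ℝ) : ℝ := a * s

/-- `α_s^min = s^(s/(s-1))`. -/
noncomputable def alphaMin (s : ℝ) : ℝ := s ^ (s / (s - 1))

/-- `α_s(u) = (s-1)/(u-u^s)`. -/
noncomputable def alphaS (s u : ℝ) : ℝ := (s - 1) / (u - u ^ s)

/-- `u_s = (1/s)^(1/(s-1))`. -/
noncomputable def uS (s : ℝ) : ℝ := (1 / s) ^ (1 / (s - 1))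

/-- The first lower bound: `α_s(u)` for `u < u_s`, and `α_s^min` for `u ≥ u_s`. -/
noncomputable def alphaOne (s u : ℝ) : ℝ :=
  if u < uS s then alphaS s u else alphaMin s

/-- `α` is (the) positive root of the equation that determines the second lower bound at `u`. -/
def IsAlphaTwo (a s pbar u α : ℝ) : Prop :=
  0 < α ∧
    ∫ η in (u * α)..α, η ^ (s - 1) * Real.exp (-η) =
      α ^ (s - 1) / Real.exp (u * α) - pbar * α ^ (s - 1) / (cBar a s * Real.exp α)

/-- `u` is a critical dividing threshold: a point of `(0,1)` where the first lower bound and the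
second one agree. -/
def IsCDT (a s pbar u : ℝ) : Prop :=
  u ∈ Set.Ioo (0 : ℝ) 1 ∧ IsAlphaTwo a s pbar u (alphaOne s u)

/-- The constant `C_s`. -/
noncomputable def cS (a s : ℝ) : ℝ :=
  cBar a s *
    (1 / Real.exp s - 1 / s ^ s * ∫ η in s..alphaMin s, η ^ (s - 1) * Real.exp (-η)) *
      Real.exp (alphaMin s)

/-! Both bounds come from one price curve `φ` with potential `Φ` (`Φ' = φ`), built so that the
conjugate of the cost over `[0,1]` satisfies `f*(φ(y)) = α (Φ(y) - f(y))` for all utilizations `y`.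
On `[0,u]` this is solved by `φ(y) = f'(y/u)`; after `u` the price exceeds `f'(1)`, the conjugate is
`φ - f(1)`, and differentiating gives `φ' = α (φ - f')`. The two pieces of `Φ` fit together exactly
when `α (u - u^s) = s - 1`.

Achievability (`achievable_of_priceCurve`) is a primal-dual argument. Each customer receives a
feasible bundle of maximal surplus at the posted prices. The surpluses and the final prices are a
dual solution up to a small error, and the identity above makes its value at most `α` times the
online welfare plus that error. A bundle that no longer fits is covered by the price at full
capacity, so `pbar ≤ φ(1)` is needed.

Optimality: single-minded customers arrive at slowly rising prices. Any algorithm of ratio `β`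
yields a sales curve `x(p)` with integral `Q` whose profit is nearly at least `f*(p)/β` at every
price (`exists_salesCurve`). Let `R` be the corresponding integral for the reference curve. With a
weight `M` such that `M'/M = -φ'/(φ - f')`, convexity of `f` forces `M (Q∘φ - R)` to grow if `β <
α`, up to the additive error (`weighted_excess_le`), while the profit condition bounds `Q` above at
the end (`IsSalesCurve.gain_le`). Near zero, `M` times the conjugate is proportional to `y^(s -
αu)`. If `αu = s`, the accumulated gain diverges logarithmically at low prices, so `α` is optimal
for every `pbar > 0`. If `αu < s`, the starting term vanishes and the contradiction comes from
following the curve up to `φ(1) ≤ pbar`.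

The value `u = u_s` gives `αu = s` and `φ(1) = C_s`, which settles `pbar ≤ C_s`. For larger `pbar`,
the threshold equation says `φ(1) = pbar`; as `φ(1)` decreases strictly in `u` and is unbounded as
`u → 0`, there is one solution, and it lies below `u_s`. -/

/-! ### Achievability: posted prices and weak duality. -/

section PostedPrices

open Set Filter Topology

variable {K : ℕ} {B : Finset (Bundle K)}

/-- The surplus of a customer who buys `b` at utilization `y`, when the price of a bundle is the
increment of the separable potential `∑ k, Φ (y k)`. -/
def surplus (Φ : ℝ → ℝ) (y : Fin K → ℝ) (v : BundleValuation B)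
    (b : {b : Bundle K // b ∈ B}) : ℝ :=
  v b - ∑ k, (Φ (y k + b.1 k) - Φ (y k))

/-- The assumption on `y` stands inside the existential so that `pick` is total, also on overfull
states. -/
theorem exists_surplus_maximizer (h0 : (0 : Bundle K) ∈ B) (Φ : ℝ → ℝ) (y : Fin K → ℝ)
    (v : BundleValuation B) :
    ∃ b : {b : Bundle K // b ∈ B}, (∀ k, y k ≤ 1) →
      (∀ k, y k + b.1 k ≤ 1) ∧
      ∀ b' : {b : Bundle K // b ∈ B}, (∀ k, y k + b'.1 k ≤ 1) →
        surplus Φ y v b' ≤ surplus Φ y v b := by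
  classical
  by_cases hy : ∀ k, y k ≤ 1
  · obtain ⟨b, hb, hmax⟩ := Finset.exists_max_image
      (Finset.univ.filter fun b : {b : Bundle K // b ∈ B} => ∀ k, y k + b.1 k ≤ 1)
      (surplus Φ y v) ⟨⟨0, h0⟩, by simpa using hy⟩
    refine ⟨b, fun _ => ⟨by simpa using hb, fun b' hb' => hmax b' (by simpa using hb')⟩⟩
  · exact ⟨⟨0, h0⟩, fun h => absurd h hy⟩

/-- A feasible bundle of maximal surplus. -/
noncomputable def pick (h0 : (0 : Bundle K) ∈ B) (Φ : ℝ → ℝ) (y : Fin K → ℝ)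
    (v : BundleValuation B) : {b : Bundle K // b ∈ B} :=
  (exists_surplus_maximizer h0 Φ y v).choose

/-- The utilization after the customers in the list have been served at the posted prices. -/
noncomputable def pickState (h0 : (0 : Bundle K) ∈ B) (Φ : ℝ → ℝ)
    (A : List (BundleValuation B)) : Fin K → ℝ :=
  A.foldl (fun y v => y + (pick h0 Φ y v).1) 0

/-- The posted price mechanism with potential `Φ`. -/
noncomputable def postedPriceRule (h0 : (0 : Bundle K) ∈ B) (Φ : ℝ → ℝ) : OnlineRule B :=
  fun A v => pick h0 Φ (pickState h0 Φ A) v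

theorem pickState_take_succ (h0 : (0 : Bundle K) ∈ B) (Φ : ℝ → ℝ) (A : ArrivalInstance B)
    (n : Fin A.length) :
    pickState h0 Φ (A.take (n + 1)) =
      pickState h0 Φ (A.take n) + ((postedPriceRule h0 Φ).run A n).1 := by
  rw [List.take_add_one, List.getElem?_eq_getElem n.2, pickState, Option.toList_some,
    List.foldl_append]
  rfl

theorem pickState_le_one (h0 : (0 : Bundle K) ∈ B) (Φ : ℝ → ℝ) (A : List (BundleValuation B))
    (k : Fin K) : pickState h0 Φ A k ≤ 1 := by
  induction A using List.reverseRecOn generalizing k with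
  | nil => simp [pickState]
  | append_singleton A v ih =>
    have h := ((exists_surplus_maximizer h0 Φ (pickState h0 Φ A) v).choose_spec ih).1 k
    simpa [pickState, List.foldl_append, pick] using h

/-- A telescoping sum, used with `g = id` for the utilization and with `g = Φ` for the revenue. -/
theorem sum_run_increment (h0 : (0 : Bundle K) ∈ B) (Φ : ℝ → ℝ) (A : ArrivalInstance B)
    (g : ℝ → ℝ) (k : Fin K) :
    ∑ n : Fin A.length, (g (pickState h0 Φ (A.take n) k + ((postedPriceRule h0 Φ).run A n).1 k)
        - g (pickState h0 Φ (A.take n) k)) = g (pickState h0 Φ A k) - g 0 := by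
  have h := Finset.sum_range_sub (fun n => g (pickState h0 Φ (A.take n) k)) A.length
  rw [List.take_length, List.take_zero] at h
  have h00 : pickState h0 Φ ([] : List (BundleValuation B)) k = 0 := rfl
  rw [h00] at h
  rw [← h, Finset.sum_range]
  refine Finset.sum_congr rfl fun n _ => ?_
  rw [pickState_take_succ]
  rfl

theorem utilization_postedPriceRule (h0 : (0 : Bundle K) ∈ B) (Φ : ℝ → ℝ)
    (A : ArrivalInstance B) (k : Fin K) :
    utilization ((postedPriceRule h0 Φ).run A) k = pickState h0 Φ A k := by
  have h := sum_run_increment h0 Φ A id k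
  simpa [utilization] using h

/-- A price curve `φ` with antiderivative-like potential `Φ` for which the dual value `φ(y) z - f(z)`
is at most `α` times the primal value `Φ(y) - f(y)` yields `α`-competitive posted prices. -/
theorem achievable_of_priceCurve (f φ Φ : ℝ → ℝ) (pbar α : ℝ) (hα : 1 ≤ α)
    (hmono : MonotoneOn φ (Icc 0 1)) (hcont : ContinuousOn φ (Icc 0 1)) (hφ0 : 0 ≤ φ 0)
    (hΦ0 : Φ 0 = 0)
    (hslope : ∀ x y, 0 ≤ x → x ≤ y → y ≤ 1 → Φ y - Φ x ≤ (y - x) * φ y)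
    (hpbar : pbar ≤ φ 1)
    (hdual : ∀ y ∈ Icc (0 : ℝ) 1, ∀ z ∈ Icc (0 : ℝ) 1, φ y * z - f z ≤ α * (Φ y - f y))
    (δ : ℝ) (hδ : 0 < δ) :
    ∃ ε : ℝ, 0 < ε ∧ ∀ B : Finset (Bundle K), IsBundleSet B ε → Achievable f pbar B α δ := by
  have hα0 : 0 < α := by linarith
  -- The error is split over the resources; `K + 1` instead of `K` avoids a division by zero.
  obtain ⟨ε₀, hε₀, hunif⟩ := Metric.uniformContinuousOn_iff.1
    (isCompact_Icc.uniformContinuousOn_of_continuous hcont) (δ / (K + 1)) (by positivity)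
  refine ⟨ε₀ / 2, by positivity, fun B hB => ?_⟩
  set ε := ε₀ / 2 with hε
  have h0 := hB.empty_mem
  have hstep : ∀ (A : ArrivalInstance B) k, Monotone fun n => pickState h0 Φ (A.take n) k := by
    intro A k
    refine monotone_nat_of_le_succ fun n => ?_
    by_cases hn : n < A.length
    · have h1 := congrFun (pickState_take_succ h0 Φ A ⟨n, hn⟩) k
      have h2 := hB.nonneg _ ((postedPriceRule h0 Φ).run A ⟨n, hn⟩).2 k
      simp only [Pi.add_apply] at h1
      linarith
    · rw [List.take_of_length_le (by omega), List.take_of_length_le (by omega)]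
  have hpos : ∀ (A : ArrivalInstance B) k, 0 ≤ pickState h0 Φ A k := by
    intro A k
    have := hstep A k (Nat.zero_le A.length)
    simpa [pickState] using this
  refine ⟨postedPriceRule h0 Φ, fun A _ k => ?_, fun A hA => ?_⟩
  · rw [utilization_postedPriceRule]
    exact ⟨hpos A k, pickState_le_one h0 Φ A k⟩
  set alg := postedPriceRule h0 Φ with halg
  set Y := pickState h0 Φ A with hY
  set S : ℕ → Fin K → ℝ := fun n => pickState h0 Φ (A.take n) with hS
  have hSY : ∀ n k, n ≤ A.length → S n k ≤ Y k := by
    intro n k hn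
    have := hstep A k hn
    simpa [hS, hY] using this
  have hS0 : ∀ n k, 0 ≤ S n k := fun n k => hpos _ k
  have hS1 : ∀ n k, S n k ≤ 1 := fun n k => pickState_le_one h0 Φ _ k
  have hY0 : ∀ k, 0 ≤ Y k := hpos A
  have hY1 : ∀ k, Y k ≤ 1 := pickState_le_one h0 Φ A
  have hεpos : 0 < ε := by positivity
  -- The dual price is read `ε` beyond the final utilization, so that it dominates the unit price of
  -- every small bundle at every earlier state.
  set lam : Fin K → ℝ := fun k => φ (min (Y k + ε) 1) with hlam
  have hmin : ∀ k, min (Y k + ε) 1 ∈ Icc (0 : ℝ) 1 := fun k =>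
    ⟨le_min (by linarith [hY0 k]) zero_le_one, min_le_right _ _⟩
  have hlam0 : ∀ k, 0 ≤ lam k := fun k =>
    hφ0.trans (hmono ⟨le_rfl, zero_le_one⟩ (hmin k) (hmin k).1)
  have hlamY : ∀ k, lam k ≤ φ (Y k) + δ / (K + 1) := by
    intro k
    have h1 := hunif _ (hmin k) _ ⟨hY0 k, hY1 k⟩ (by
      rw [Real.dist_eq, abs_lt]
      constructor
      · have : Y k ≤ min (Y k + ε) 1 := le_min (by linarith) (hY1 k)
        linarith
      · have : min (Y k + ε) 1 ≤ Y k + ε := min_le_left _ _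
        linarith)
    rw [Real.dist_eq, abs_lt] at h1
    simp only [hlam]
    linarith [h1.2]
  set T : Fin A.length → ℝ := fun n => surplus Φ (S n) (A.get n) (alg.run A n) with hT
  have hbest : ∀ n : Fin A.length, ∀ b : {b : Bundle K // b ∈ B}, (∀ k, S n k + b.1 k ≤ 1) →
      surplus Φ (S n) (A.get n) b ≤ T n := fun n b hb =>
    ((exists_surplus_maximizer h0 Φ (S n) (A.get n)).choose_spec (hS1 n)).2 b hb
  have hadm : ∀ n : Fin A.length, BundleValuation.Admissible pbar (A.get n) := fun n =>
    hA _ (List.get_mem A n)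
  have hT0 : ∀ n, 0 ≤ T n := by
    intro n
    have := hbest n ⟨0, h0⟩ (by simpa using hS1 n)
    simpa [surplus, (hadm n).1 ⟨0, h0⟩ rfl] using this
  have hbound : ∀ (n : Fin A.length) (b : {b : Bundle K // b ∈ B}),
      A.get n b ≤ T n + ∑ k, lam k * b.1 k := by
    intro n b
    have hbn : ∀ k, 0 ≤ b.1 k := hB.nonneg _ b.2
    have hbε : ∀ k, b.1 k ≤ ε := hB.small _ b.2
    by_cases hfit : ∀ k, S n k + b.1 k ≤ 1
    · have h1 := hbest n b hfit
      have h2 : ∑ k, (Φ (S n k + b.1 k) - Φ (S n k)) ≤ ∑ k, lam k * b.1 k := by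
        refine Finset.sum_le_sum fun k _ => ?_
        have h3 := hslope (S n k) (S n k + b.1 k) (hS0 _ _) (by linarith [hbn k]) (hfit k)
        have h4 : φ (S n k + b.1 k) ≤ lam k :=
          hmono ⟨by linarith [hS0 n k, hbn k], hfit k⟩ (hmin k)
            (le_min (by linarith [hSY n k n.2.le, hbε k]) (hfit k))
        have h5 := mul_le_mul_of_nonneg_left h4 (hbn k)
        linarith
      unfold surplus at h1
      linarith
    -- A bundle that does not fit overruns a resource within `ε` of its capacity. There the dual
    -- price is `φ 1 ≥ pbar`, and this one resource pays for the whole value.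
    · push Not at hfit
      obtain ⟨k, hk⟩ := hfit
      have hbk : b.1 k ≠ 0 := by
        intro h
        have := hS1 n k
        rw [h] at hk
        linarith
      have hbk' : 0 < b.1 k := lt_of_le_of_ne (hbn k) (Ne.symm hbk)
      have h1 := (div_le_iff₀ hbk').1 ((hadm n).2 b k hbk)
      have h2 : lam k = φ 1 := by
        simp only [hlam]
        rw [min_eq_right]
        linarith [hSY n k n.2.le, hbε k]
      have h3 : lam k * b.1 k ≤ ∑ k, lam k * b.1 k :=
        Finset.single_le_sum (f := fun k => lam k * b.1 k)
          (fun j _ => mul_nonneg (hlam0 j) (hbn j)) (Finset.mem_univ k)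
      have h4 : pbar * b.1 k ≤ lam k * b.1 k := by
        rw [h2]; exact mul_le_mul_of_nonneg_right hpbar hbk'.le
      linarith [hT0 n]
  have honline : welfare f A (alg.run A) = ∑ n, T n + ∑ k, (Φ (Y k) - f (Y k)) := by
    have h1 : ∑ n : Fin A.length, ∑ k, (Φ (S n k + (alg.run A n).1 k) - Φ (S n k))
        = ∑ k, Φ (Y k) := by
      rw [Finset.sum_comm]
      refine Finset.sum_congr rfl fun k _ => ?_
      rw [sum_run_increment h0 Φ A Φ k, hΦ0, sub_zero]
    simp only [welfare, hT, surplus, Finset.sum_sub_distrib] at h1 ⊢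
    have h2 : ∀ k, utilization (alg.run A) k = Y k := utilization_postedPriceRule h0 Φ A
    simp only [h2]
    linarith
  -- Weak duality: `hbound` is dual feasibility, and `hdual` bounds the conjugate at the final
  -- price.
  have hopt : optWelfare f A ≤ ∑ n, T n + ∑ k, (α * (Φ (Y k) - f (Y k)) + δ / (K + 1)) := by
    refine csSup_le ⟨_, fun _ => ⟨0, h0⟩, fun k => by simp [utilization], rfl⟩ ?_
    rintro w ⟨x, hx, rfl⟩
    have h1 : ∑ n, A.get n (x n) ≤ ∑ n, T n + ∑ k, lam k * utilization x k := by
      calc ∑ n, A.get n (x n) ≤ ∑ n, (T n + ∑ k, lam k * (x n).1 k) :=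
            Finset.sum_le_sum fun n _ => hbound n (x n)
        _ = _ := by
            rw [Finset.sum_add_distrib, Finset.sum_comm]
            simp only [utilization, Finset.mul_sum]
    have h2 : ∑ k, (lam k * utilization x k - f (utilization x k))
        ≤ ∑ k, (α * (Φ (Y k) - f (Y k)) + δ / (K + 1)) := by
      refine Finset.sum_le_sum fun k _ => ?_
      have h3 := hdual (Y k) ⟨hY0 k, hY1 k⟩ _ (hx k)
      have h4 := mul_le_mul_of_nonneg_right (hlamY k) (hx k).1
      have h5 : δ / (K + 1) * utilization x k ≤ δ / (K + 1) :=
        mul_le_of_le_one_right (by positivity) (hx k).2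
      linarith
    rw [Finset.sum_sub_distrib] at h2
    unfold welfare
    linarith
  have hsum : ∑ k : Fin K, (α * (Φ (Y k) - f (Y k)) + δ / (K + 1))
      ≤ α * ∑ k, (Φ (Y k) - f (Y k)) + δ := by
    rw [Finset.sum_add_distrib, ← Finset.mul_sum]
    have : ∑ _k : Fin K, δ / ((K : ℝ) + 1) ≤ δ := by
      rw [Finset.sum_const, Finset.card_univ, Fintype.card_fin, nsmul_eq_mul, mul_div_assoc',
        div_le_iff₀ (by positivity)]
      linarith
    linarith
  have hTsum : 0 ≤ ∑ n, T n := Finset.sum_nonneg fun n _ => hT0 n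
  rw [honline, one_div, inv_mul_eq_div, sub_le_iff_le_add, div_le_iff₀ hα0]
  have h6 : ∑ n, T n ≤ α * ∑ n, T n := le_mul_of_one_le_left hTsum hα
  have h7 : δ ≤ α * δ := le_mul_of_one_le_left hδ.le hα
  linarith

end PostedPrices

/-! ### From an online algorithm to a sales curve. -/

section SalesCurve

open Set Filter Topology

variable {K : ℕ} {B : Finset (Bundle K)}

open Classical in
/-- The valuation that assigns `w` to the bundle `b₀` and `0` to all other bundles. -/
noncomputable def singleValuation (b₀ : {b : Bundle K // b ∈ B}) (w : ℝ) : BundleValuation B :=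
  fun b => if b = b₀ then w else 0

/-- Customers `0, …, m-1` that only want `b₀`, at total values `w 0, …, w (m-1)`. -/
noncomputable def singleInstance (b₀ : {b : Bundle K // b ∈ B}) (w : ℕ → ℝ) (m : ℕ) :
    ArrivalInstance B :=
  (List.range m).map fun n => singleValuation b₀ (w n)

theorem length_singleInstance (b₀ : {b : Bundle K // b ∈ B}) (w : ℕ → ℝ) (m : ℕ) :
    (singleInstance b₀ w m).length = m := by simp [singleInstance]

theorem get_singleInstance (b₀ : {b : Bundle K // b ∈ B}) (w : ℕ → ℝ) (m : ℕ)
    (n : Fin (singleInstance b₀ w m).length) :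
    (singleInstance b₀ w m).get n = singleValuation b₀ (w n) := by
  rw [List.get_eq_getElem]
  simp only [singleInstance, List.getElem_map, List.getElem_range]

theorem take_singleInstance (b₀ : {b : Bundle K // b ∈ B}) (w : ℕ → ℝ) {m n : ℕ} (h : n ≤ m) :
    (singleInstance b₀ w m).take n = singleInstance b₀ w n := by
  simp [singleInstance, ← List.map_take, List.take_range, h]

theorem admissible_singleInstance {pbar : ℝ} (hp : 0 ≤ pbar) {b₀ : {b : Bundle K // b ∈ B}}
    {k₀ : Fin K} (hr : 0 < b₀.1 k₀) (h0 : ∀ j, j ≠ k₀ → b₀.1 j = 0) (p : ℕ → ℝ) (m : ℕ)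
    (hle : ∀ n, p n ≤ pbar) :
    ArrivalInstance.Admissible pbar (singleInstance b₀ (fun n => p n * b₀.1 k₀) m) := by
  intro v hv
  simp only [singleInstance, List.mem_map] at hv
  obtain ⟨n, -, rfl⟩ := hv
  refine ⟨fun b hb => ?_, fun b k hk => ?_⟩
  · have : b ≠ b₀ := by
      rintro rfl
      rw [hb] at hr
      simp at hr
    simp [singleValuation, this]
  · by_cases h : b = b₀
    · subst h
      have hkk : k = k₀ := by
        by_contra h
        exact hk (h0 k h)
      subst hkk
      simpa [singleValuation, hr.ne'] using hle n
    · simpa [singleValuation, h] using hp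

theorem bddAbove_welfare (f : ℝ → ℝ) (A : ArrivalInstance B) :
    BddAbove {w : ℝ | ∃ x : Allocation A, Allocation.Feasible x ∧ w = welfare f A x} := by
  refine ((Set.finite_range fun x : Allocation A => welfare f A x).subset ?_).bddAbove
  rintro w ⟨x, -, rfl⟩
  exact ⟨x, rfl⟩

/-- The offline optimum can sell `m₀` copies of `b₀` to the last customers. -/
theorem le_optWelfare_singleInstance {f : ℝ → ℝ} (hf0 : f 0 = 0) (hB0 : (0 : Bundle K) ∈ B)
    {b₀ : {b : Bundle K // b ∈ B}}
    {k₀ : Fin K} (hr : 0 < b₀.1 k₀) (h0 : ∀ j, j ≠ k₀ → b₀.1 j = 0) (p : ℕ → ℝ) (m l m₀ : ℕ) (t : ℝ)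
    (hm : l + m₀ ≤ m) (hpt : ∀ n, l ≤ n → n < l + m₀ → p n = t) (hcap : m₀ * b₀.1 k₀ ≤ 1) :
    t * (m₀ * b₀.1 k₀) - f (m₀ * b₀.1 k₀) ≤
      optWelfare f (singleInstance b₀ (fun n => p n * b₀.1 k₀) m) := by
  classical
  set A := singleInstance b₀ (fun n => p n * b₀.1 k₀) m with hA
  have hlen : A.length = m := length_singleInstance _ _ _
  let x : Allocation A := fun n => if n.1 ∈ Finset.Ico l (l + m₀) then b₀ else ⟨0, hB0⟩
  have hfilter : (Finset.range A.length).filter (fun n => n ∈ Finset.Ico l (l + m₀)) =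
      Finset.Ico l (l + m₀) := by
    ext n
    simp only [Finset.mem_filter, Finset.mem_range, Finset.mem_Ico, hlen]
    omega
  have hsum : ∀ c : ℝ, ∑ n : Fin A.length, (if n.1 ∈ Finset.Ico l (l + m₀) then c else 0) =
      m₀ * c := by
    intro c
    rw [Fin.sum_univ_eq_sum_range (fun n => if n ∈ Finset.Ico l (l + m₀) then c else 0),
      ← Finset.sum_filter, hfilter]
    simp
  have hu : ∀ k, utilization x k = m₀ * b₀.1 k := by
    intro k
    rw [← hsum, utilization]
    refine Finset.sum_congr rfl fun n _ => ?_
    simp only [x]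
    split_ifs <;> rfl
  have hv : ∑ n, A.get n (x n) = m₀ * (t * b₀.1 k₀) := by
    rw [← hsum]
    refine Finset.sum_congr rfl fun n _ => ?_
    rw [get_singleInstance]
    simp only [x]
    split_ifs with hn
    · rw [Finset.mem_Ico] at hn
      simp [singleValuation, hpt n.1 hn.1 hn.2]
    · have : (⟨0, hB0⟩ : {b : Bundle K // b ∈ B}) ≠ b₀ := by
        intro h
        rw [← h] at hr
        simp at hr
      simp [singleValuation, this]
  refine le_csSup (bddAbove_welfare f A) ⟨x, fun k => ?_, ?_⟩
  · rw [hu]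
    by_cases hk : k = k₀
    · subst hk
      exact ⟨by positivity, hcap⟩
    · rw [h0 k hk]; simp
  · rw [welfare, hv, Finset.sum_eq_single k₀, hu]
    · ring
    · intro k _ hk
      rw [hu, h0 k hk, mul_zero, hf0]
    · simp

open Classical in
/-- Number of units that the rule sells to customer `n` of an instance with single-minded
customers. -/
noncomputable def soldUnits (alg : OnlineRule B) (b₀ : {b : Bundle K // b ∈ B}) (r : ℝ)
    (w : ℕ → ℝ) (n : ℕ) : ℝ :=
  if alg (singleInstance b₀ w n) (singleValuation b₀ (w n)) = b₀ then r else 0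

/-- The decision on customer `n` does not depend on the length `m`, so one sequence of sold units
describes the rule on all prefixes. -/
theorem run_singleInstance (alg : OnlineRule B) (b₀ : {b : Bundle K // b ∈ B}) (w : ℕ → ℝ) (m : ℕ)
    (n : Fin (singleInstance b₀ w m).length) :
    alg.run (singleInstance b₀ w m) n =
      alg (singleInstance b₀ w n) (singleValuation b₀ (w n)) := by
  have hn : n.1 ≤ m := n.2.le.trans_eq (length_singleInstance b₀ w m)
  rw [OnlineRule.run, get_singleInstance, take_singleInstance _ _ hn]

theorem sum_soldUnits_le (hnn : ∀ b ∈ B, ∀ k, 0 ≤ b k) (alg : OnlineRule B)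
    (b₀ : {b : Bundle K // b ∈ B}) (k₀ : Fin K) (w : ℕ → ℝ) (m : ℕ) :
    ∑ n ∈ Finset.range m, soldUnits alg b₀ (b₀.1 k₀) w n ≤
      utilization (alg.run (singleInstance b₀ w m)) k₀ := by
  have hlen : (singleInstance b₀ w m).length = m := length_singleInstance _ _ _
  conv_lhs => rw [← hlen]
  rw [Finset.sum_range, utilization]
  refine Finset.sum_le_sum fun n _ => ?_
  rw [run_singleInstance, soldUnits]
  split_ifs with h
  · rw [h]
  · exact hnn _ (Subtype.property _) _

/-- Bundles other than `b₀` have no value for these customers and can only raise the cost. -/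
theorem welfare_run_singleInstance_le {f : ℝ → ℝ} (hf : MonotoneOn f (Icc 0 1)) (hf0 : f 0 = 0)
    (hnn : ∀ b ∈ B, ∀ k, 0 ≤ b k) (alg : OnlineRule B)
    (b₀ : {b : Bundle K // b ∈ B}) (k₀ : Fin K) (p : ℕ → ℝ) (m : ℕ)
    (hfeas : Allocation.Feasible
      (alg.run (singleInstance b₀ (fun n => p n * b₀.1 k₀) m))) :
    welfare f (singleInstance b₀ (fun n => p n * b₀.1 k₀) m)
        (alg.run (singleInstance b₀ (fun n => p n * b₀.1 k₀) m)) ≤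
      ∑ n ∈ Finset.range m, p n * soldUnits alg b₀ (b₀.1 k₀) (fun n => p n * b₀.1 k₀) n -
        f (∑ n ∈ Finset.range m, soldUnits alg b₀ (b₀.1 k₀) (fun n => p n * b₀.1 k₀) n) := by
  set w : ℕ → ℝ := fun n => p n * b₀.1 k₀ with hw
  set A := singleInstance b₀ w m with hA
  have hlen : A.length = m := length_singleInstance _ _ _
  have h1 : ∑ n, A.get n (alg.run A n) =
      ∑ n ∈ Finset.range m, p n * soldUnits alg b₀ (b₀.1 k₀) w n := by
    conv_rhs => rw [← hlen]
    rw [Finset.sum_range]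
    refine Finset.sum_congr rfl fun n _ => ?_
    rw [get_singleInstance, run_singleInstance, soldUnits, singleValuation]
    split_ifs <;> simp [hw]
  have hs0 : 0 ≤ ∑ n ∈ Finset.range m, soldUnits alg b₀ (b₀.1 k₀) w n := by
    refine Finset.sum_nonneg fun n _ => ?_
    rw [soldUnits]
    split_ifs
    · exact hnn _ b₀.2 _
    · exact le_rfl
  have h2 := sum_soldUnits_le hnn alg b₀ k₀ w m
  have h3 : f (∑ n ∈ Finset.range m, soldUnits alg b₀ (b₀.1 k₀) w n) ≤
      ∑ k, f (utilization (alg.run A) k) := by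
    refine (hf ⟨hs0, h2.trans (hfeas k₀).2⟩ (hfeas k₀) h2).trans ?_
    refine Finset.single_le_sum (f := fun k => f (utilization (alg.run A) k)) (fun k _ => ?_)
      (Finset.mem_univ k₀)
    have := hf ⟨le_rfl, zero_le_one⟩ (hfeas k) (hfeas k).1
    simpa [hf0] using this
  rw [welfare, h1]
  linarith

theorem hasDerivWithinAt_max_sub (t p : ℝ) :
    HasDerivWithinAt (fun q => max (q - t) 0) (if t ≤ p then 1 else 0) (Ici p) p := by
  split_ifs with h
  · refine ((hasDerivAt_id p).sub_const t).hasDerivWithinAt.congr (fun q hq => ?_) ?_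
    · exact max_eq_left (by have : p ≤ q := hq; linarith)
    · exact max_eq_left (by simpa using h)
  · push Not at h
    refine HasDerivAt.hasDerivWithinAt ?_
    refine (hasDerivAt_const p (0 : ℝ)).congr_of_eventuallyEq ?_
    filter_upwards [Iio_mem_nhds h] with q hq
    exact max_eq_right (by have : q < t := hq; linarith)

/-- `x p` units of a resource are sold at prices up to `p`, `Q` is the integral of `x`, and at every
price the profit `p x(p) - Q(p) - f(x(p))` is, up to `δ`, at least a `1 / β` fraction of the
conjugate of `f`. -/
structure IsSalesCurve (f : ℝ → ℝ) (pbar β δ : ℝ) (x Q : ℝ → ℝ) : Prop where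
  mem_Icc : ∀ p, x p ∈ Icc (0 : ℝ) 1
  continuous : Continuous Q
  hasDeriv : ∀ p, HasDerivWithinAt Q (x p) (Ici p) p
  nonneg : ∀ p, 0 ≤ Q p
  profit : ∀ p ∈ Icc 0 pbar, ∀ z ∈ Icc (0 : ℝ) 1,
    (p * z - f z) / β - δ ≤ p * x p - f (x p) - Q p

/-- If the ratio `β` is achievable for small bundles, then there is a sales curve for `β`, up to an
arbitrarily small error. -/
theorem exists_salesCurve {f : ℝ → ℝ} (hf : MonotoneOn f (Icc 0 1)) (hf0 : f 0 = 0) {pbar β δ' : ℝ}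
    (hp : 0 < pbar) (hβ : 1 ≤ β) (hδ' : 0 < δ') :
    ∃ δ : ℝ, 0 < δ ∧ ∃ ε : ℝ, 0 < ε ∧ ∀ B : Finset (Bundle K), IsBundleSet B ε →
      HasSingleResourceBundle B → Achievable f pbar B β δ →
      ∃ x Q : ℝ → ℝ, IsSalesCurve f pbar β δ' x Q := by
  -- Three errors share `δ'`: the additive error of the algorithm, the mesh `h` of the price grid,
  -- and the rounding of a quantity to copies of `b₀`, which costs at most `pbar * r`.
  refine ⟨δ' / 3, by positivity, δ' / (3 * pbar), by positivity, ?_⟩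
  rintro B hB ⟨b, hbB, k₀, hr, h0⟩ ⟨alg, hfeas, hcomp⟩
  have hβ0 : 0 < β := by linarith
  set b₀ : {b : Bundle K // b ∈ B} := ⟨b, hbB⟩ with hb₀
  set r := b₀.1 k₀ with hrdef
  have hr' : 0 < r := hr
  obtain ⟨M, hM⟩ := exists_nat_gt (pbar / (δ' / 3))
  have hM0 : (0 : ℝ) < M := lt_trans (by positivity) hM
  set h := pbar / M with hh
  have hhpos : 0 < h := by positivity
  have hhδ : h ≤ δ' / 3 := by
    rw [hh, div_le_iff₀ hM0]
    rw [div_lt_iff₀ (by positivity)] at hM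
    linarith
  have hMh : M * h = pbar := by rw [hh]; field_simp
  obtain ⟨N, hN⟩ := exists_nat_ge (1 / r)
  have hN0 : 0 < N := by
    have : (0 : ℝ) < N := lt_of_lt_of_le (by positivity) hN
    exact_mod_cast this
  -- The price levels are `0, h, …, M h = pbar`, with `N ≥ 1 / r` customers each, enough to fill the
  -- capacity at any level. The quotient `n / N` below is the level of customer `n`; the cap at
  -- `pbar` matters only for `n ≥ T`.
  set T := (M + 1) * N with hT
  set pr : ℕ → ℝ := fun n => min ((n / N : ℕ) * h) pbar with hpr
  set w : ℕ → ℝ := fun n => pr n * r with hw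
  set d : ℕ → ℝ := soldUnits alg b₀ r w with hd
  have hd0 : ∀ n, 0 ≤ d n := by
    intro n
    simp only [hd, soldUnits]
    split_ifs
    · exact hr'.le
    · exact le_rfl
  have hadm : ∀ m, ArrivalInstance.Admissible pbar (singleInstance b₀ w m) := fun m =>
    admissible_singleInstance hp.le hr h0 pr m fun n => min_le_right _ _
  refine ⟨fun p => ∑ n ∈ Finset.range T, d n * (if pr n ≤ p then 1 else 0),
    fun p => ∑ n ∈ Finset.range T, d n * max (p - pr n) 0, fun p => ⟨?_, ?_⟩, ?_, ?_, ?_, ?_⟩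
  · refine Finset.sum_nonneg fun n _ => mul_nonneg (hd0 n) ?_
    split_ifs <;> norm_num
  · calc _ ≤ ∑ n ∈ Finset.range T, d n := by
          refine Finset.sum_le_sum fun n _ => mul_le_of_le_one_right (hd0 n) ?_
          split_ifs <;> norm_num
      _ ≤ _ := sum_soldUnits_le hB.nonneg alg b₀ k₀ w T
      _ ≤ 1 := (hfeas _ (hadm T) k₀).2
  · fun_prop
  · intro p
    exact HasDerivWithinAt.fun_sum fun n _ => (hasDerivWithinAt_max_sub (pr n) p).const_mul (d n)
  · exact fun p => Finset.sum_nonneg fun n _ => mul_nonneg (hd0 n) (le_max_right _ _)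
  · rintro p ⟨hp0, hpp⟩ z ⟨hz0, hz1⟩
    -- To test the price `p`, the instance is stopped after the last level `i` not above `p`; the
    -- offline comparison sells to that level only.
    set i := ⌊p / h⌋₊ with hi
    have hi1 : i * h ≤ p := by
      rw [← le_div_iff₀ hhpos]; exact Nat.floor_le (by positivity)
    have hi2 : p < (i + 1) * h := by
      rw [← div_lt_iff₀ hhpos]; exact Nat.lt_floor_add_one _
    have hiM : i ≤ M := by
      have : p / h ≤ M := by rw [div_le_iff₀ hhpos]; linarith
      exact_mod_cast (Nat.floor_le (by positivity)).trans this
    set m := (i + 1) * N with hm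
    have hmT : m ≤ T := Nat.mul_le_mul_right _ (by omega)
    have hprm : ∀ n, n < T → (pr n ≤ p ↔ n < m) := by
      intro n hn
      rw [hm, ← Nat.div_lt_iff_lt_mul hN0]
      have hnM : n / N ≤ M := by
        have := (Nat.div_lt_iff_lt_mul hN0).2 hn
        omega
      have : pr n = (n / N : ℕ) * h := by
        refine min_eq_left ?_
        rw [← hMh]
        exact mul_le_mul_of_nonneg_right (by exact_mod_cast hnM) hhpos.le
      rw [this]
      constructor
      · intro hle
        have : ((n / N : ℕ) : ℝ) * h < (i + 1) * h := lt_of_le_of_lt hle hi2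
        have := lt_of_mul_lt_mul_right this hhpos.le
        exact_mod_cast this
      · intro hlt
        refine le_trans (mul_le_mul_of_nonneg_right ?_ hhpos.le) hi1
        exact_mod_cast Nat.lt_succ_iff.1 hlt
    have hsplit : ∀ g : ℕ → ℝ, ∑ n ∈ Finset.range T, (if pr n ≤ p then g n else 0) =
        ∑ n ∈ Finset.range m, g n := by
      intro g
      rw [← Finset.sum_filter]
      refine Finset.sum_congr ?_ fun _ _ => rfl
      ext n
      simp only [Finset.mem_filter, Finset.mem_range]
      constructor
      · rintro ⟨h1, h2⟩
        exact (hprm n h1).1 h2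
      · intro h1
        exact ⟨by omega, (hprm n (by omega)).2 h1⟩
    have hx : ∑ n ∈ Finset.range T, d n * (if pr n ≤ p then 1 else 0) =
        ∑ n ∈ Finset.range m, d n := by
      rw [← hsplit]
      simp
    have hQ : ∑ n ∈ Finset.range T, d n * max (p - pr n) 0 =
        ∑ n ∈ Finset.range m, d n * (p - pr n) := by
      rw [← hsplit]
      refine Finset.sum_congr rfl fun n _ => ?_
      split_ifs with hc
      · rw [max_eq_left (by linarith)]
      · rw [max_eq_right (by linarith), mul_zero]
    simp only [hx, hQ]
    have hon := welfare_run_singleInstance_le hf hf0 hB.nonneg alg b₀ k₀ pr m (hfeas _ (hadm m))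
    have hc := hcomp _ (hadm m)
    set m₀ := ⌊z / r⌋₊ with hm₀
    have hm1 : m₀ * r ≤ z := by
      rw [← le_div_iff₀ hr']; exact Nat.floor_le (by positivity)
    have hm2 : z < (m₀ + 1) * r := by
      rw [← div_lt_iff₀ hr']; exact Nat.lt_floor_add_one _
    have hmN : m₀ ≤ N := by
      have h1 : z / r ≤ N := le_trans (by gcongr) hN
      exact_mod_cast (Nat.floor_le (by positivity)).trans h1
    have hihp : i * h ≤ pbar := hi1.trans hpp
    have hopt := le_optWelfare_singleInstance hf0 hB.empty_mem hr h0 pr m (i * N) m₀ (i * h)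
      (by rw [hm]; nlinarith) (fun n hn1 hn2 => by
        have : n / N = i := by
          rw [Nat.div_eq_iff hN0]
          constructor
          · exact hn1
          · rw [add_comm] at hn2; omega
        simp only [hpr]
        rw [this]
        exact min_eq_left hihp) (hm1.trans hz1)
    have hfm : f (m₀ * r) ≤ f z :=
      hf ⟨by positivity, hm1.trans hz1⟩ ⟨hz0, hz1⟩ hm1
    have hrε : pbar * r ≤ δ' / 3 := by
      have h1 : r ≤ δ' / (3 * pbar) := hB.small b hbB k₀
      calc pbar * r ≤ pbar * (δ' / (3 * pbar)) := by gcongr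
        _ = δ' / 3 := by field_simp
    have hlow : p * z - f z - 2 * (δ' / 3) ≤ i * h * (m₀ * r) - f (m₀ * r) := by
      have h1 : (i * h) * (z - r) ≤ i * h * (m₀ * r) :=
        mul_le_mul_of_nonneg_left (by linarith) (by positivity)
      have h2 : (p - i * h) * z ≤ δ' / 3 := by
        have h3 : (p - i * h) * z ≤ p - i * h := mul_le_of_le_one_right (by linarith) hz1
        linarith
      have h4 : i * h * r ≤ pbar * r := mul_le_mul_of_nonneg_right hihp hr'.le
      linarith
    have hopt' : (p * z - f z) / β - 2 * (δ' / 3) ≤ 1 / β * optWelfare f (singleInstance b₀ w m) := by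
      have h1 := mul_le_mul_of_nonneg_left (hlow.trans hopt) (one_div_pos.2 hβ0).le
      have h2 : 1 / β * (2 * (δ' / 3)) ≤ 2 * (δ' / 3) :=
        mul_le_of_le_one_left (by positivity) ((div_le_one hβ0).2 hβ)
      have h3 : 1 / β * (p * z - f z - 2 * (δ' / 3)) =
        (p * z - f z) / β - 1 / β * (2 * (δ' / 3)) := by ring
      rw [h3] at h1
      exact le_trans (by linarith) h1
    have hfinal : p * ∑ n ∈ Finset.range m, d n - f (∑ n ∈ Finset.range m, d n) -
        ∑ n ∈ Finset.range m, d n * (p - pr n) =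
        ∑ n ∈ Finset.range m, pr n * d n - f (∑ n ∈ Finset.range m, d n) := by
      have : ∑ n ∈ Finset.range m, d n * (p - pr n) =
          p * ∑ n ∈ Finset.range m, d n - ∑ n ∈ Finset.range m, pr n * d n := by
        rw [Finset.mul_sum, ← Finset.sum_sub_distrib]
        exact Finset.sum_congr rfl fun n _ => by ring
      rw [this]
      ring
    rw [hfinal]
    linarith

end SalesCurve

/-! ### Comparison of a sales curve with a reference price curve. -/

section RightDerivatives

open Set Filter Topology

/-- One-sided derivatives are needed since `Q` has kinks at the customers' prices and the price
curve may have one at `u`. -/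
theorem le_of_right_deriv_nonneg {W W' : ℝ → ℝ} {x y : ℝ} (hxy : x ≤ y)
    (hW : ContinuousOn W (Icc x y))
    (hW' : ∀ t ∈ Ico x y, HasDerivWithinAt W (W' t) (Ici t) t) (h0 : ∀ t ∈ Ico x y, 0 ≤ W' t) :
    W x ≤ W y :=
  image_le_of_deriv_right_le_deriv_boundary (f := fun _ => W x) (f' := fun _ => 0)
    continuousOn_const (fun t _ => hasDerivWithinAt_const t _ _) le_rfl hW hW' h0 ⟨hxy, le_rfl⟩

theorem monotoneOn_of_right_deriv_nonneg {W W' : ℝ → ℝ} {a b : ℝ}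
    (hW : ContinuousOn W (Icc a b))
    (hW' : ∀ t ∈ Ico a b, HasDerivWithinAt W (W' t) (Ici t) t) (h0 : ∀ t ∈ Ico a b, 0 ≤ W' t) :
    MonotoneOn W (Icc a b) := fun _ hx _ hy hxy =>
  le_of_right_deriv_nonneg hxy (hW.mono (Icc_subset_Icc hx.1 hy.2))
    (fun t ht => hW' t ⟨hx.1.trans ht.1, ht.2.trans_le hy.2⟩)
    (fun t ht => h0 t ⟨hx.1.trans ht.1, ht.2.trans_le hy.2⟩)

theorem hasDerivWithinAt_ite_of_lt {g h : ℝ → ℝ} {u y d : ℝ} (hy : y < u) (hg : HasDerivAt g d y) :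
    HasDerivWithinAt (fun t => if t ≤ u then g t else h t) d (Ici y) y := by
  refine HasDerivAt.hasDerivWithinAt (hg.congr_of_eventuallyEq ?_)
  filter_upwards [Iio_mem_nhds hy] with t ht
  exact if_pos (le_of_lt ht)

theorem hasDerivWithinAt_ite_of_ge {g h : ℝ → ℝ} {u y d : ℝ} (hgh : g u = h u) (hy : u ≤ y)
    (hh : HasDerivAt h d y) :
    HasDerivWithinAt (fun t => if t ≤ u then g t else h t) d (Ici y) y := by
  have key : ∀ t, u ≤ t → (if t ≤ u then g t else h t) = h t := by
    intro t ht
    split_ifs with h1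
    · rw [le_antisymm h1 ht, hgh]
    · rfl
  exact hh.hasDerivWithinAt.congr (fun t ht => key t (hy.trans ht)) (key y hy)

/-- The excess of the sales revenue integral `Q` over that of a reference price curve `φ`,
weighted by `M`, can only grow along the curve, up to the errors `δ` and the gain `E`. -/
theorem weighted_excess_le {f fd φ φd R M r E e g x Q : ℝ → ℝ} {y₀ y₁ δ : ℝ} (hy : y₀ ≤ y₁)
    (hφ : ContinuousOn φ (Icc y₀ y₁)) (hφmono : MonotoneOn φ (Icc y₀ y₁))
    (hφd : ∀ y ∈ Ico y₀ y₁, HasDerivWithinAt φ (φd y) (Ici y) y)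
    (hR : ContinuousOn R (Icc y₀ y₁))
    (hRd : ∀ y ∈ Ico y₀ y₁, HasDerivWithinAt R (y * φd y) (Ici y) y)
    (hM : ContinuousOn M (Icc y₀ y₁))
    (hMd : ∀ y ∈ Ico y₀ y₁, HasDerivWithinAt M (-(r y * M y)) (Ici y) y)
    (hE : ContinuousOn E (Icc y₀ y₁))
    (hEd : ∀ y ∈ Ico y₀ y₁, HasDerivWithinAt E (e y) (Ici y) y)
    (hQ : Continuous Q) (hQd : ∀ p, HasDerivWithinAt Q (x p) (Ici p) p)
    (hM0 : ∀ y ∈ Ico y₀ y₁, 0 ≤ M y) (hr0 : ∀ y ∈ Ico y₀ y₁, 0 ≤ r y)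
    (hφr : ∀ y ∈ Ico y₀ y₁, φd y = r y * (φ y - fd y))
    (htangent : ∀ y ∈ Ico y₀ y₁, f y + fd y * (x (φ y) - y) ≤ f (x (φ y)))
    (hprofit : ∀ y ∈ Ico y₀ y₁,
      y * φ y - f y - R y + g y - δ ≤ φ y * x (φ y) - f (x (φ y)) - Q (φ y))
    (hgain : ∀ y ∈ Ico y₀ y₁, e y ≤ r y * M y * g y) :
    M y₀ * (Q (φ y₀) - R y₀) - δ * M y₀ - E y₀ ≤ M y₁ * (Q (φ y₁) - R y₁) - δ * M y₁ - E y₁ := by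
  refine le_of_right_deriv_nonneg (W := fun y => M y * (Q (φ y) - R y) - δ * M y - E y)
    (W' := fun y => (-(r y * M y) * (Q (φ y) - R y) + M y * (x (φ y) * φd y - y * φd y))
      - δ * (-(r y * M y)) - e y) hy ?_ ?_ ?_
  · exact ((hM.mul ((hQ.comp_continuousOn hφ).sub hR)).sub (continuousOn_const.mul hM)).sub hE
  · intro y hy
    have hQφ : HasDerivWithinAt (fun t => Q (φ t)) (x (φ y) * φd y) (Ici y) y := by
      -- `Q` has only right derivatives, so the chain rule needs `φ` to map points right of `y` to
      -- prices not below `φ y`.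
      have h1 : HasDerivWithinAt (fun t => Q (φ t)) (x (φ y) * φd y) (Icc y y₁) y :=
        HasDerivWithinAt.comp y (hQd (φ y)) ((hφd y hy).mono Icc_subset_Ici_self)
          fun t ht => hφmono ⟨hy.1, hy.2.le⟩ ⟨hy.1.trans ht.1, ht.2⟩ ht.1
      exact h1.mono_of_mem_nhdsWithin (Icc_mem_nhdsGE hy.2)
    exact (((hMd y hy).fun_mul (hQφ.fun_sub (hRd y hy))).fun_sub
      ((hMd y hy).const_mul δ)).fun_sub (hEd y hy)
  · intro y hy
    have h1 := hgain y hy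
    have h2 := hprofit y hy
    have h3 := htangent y hy
    have h4 : 0 ≤ r y * M y := mul_nonneg (hr0 y hy) (hM0 y hy)
    -- The slack in the profit condition plus the slack in the tangent inequality; with `φd = r (φ -
    -- fd)` this is the derivative of the weighted excess, up to the gain and `δ` terms.
    have h5 : 0 ≤ r y * M y * (φ y * x (φ y) - f (x (φ y)) - Q (φ y) -
        (y * φ y - f y - R y + g y - δ) + (f (x (φ y)) - (f y + fd y * (x (φ y) - y)))) :=
      mul_nonneg h4 (by linarith)
    simp only [hφr y hy]
    linarith

end RightDerivatives

/-! ### The explicit price curve for power costs. -/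

section PowerCurve

open Set Filter Topology

/-- The tangent line of a power function lies below it. -/
theorem rpow_tangent_le {s w z : ℝ} (hs : 1 < s) (hw : 0 ≤ w) (hz : 0 ≤ z) :
    w ^ s + s * w ^ (s - 1) * (z - w) ≤ z ^ s := by
  rcases hw.eq_or_lt with rfl | hw
  · rw [Real.zero_rpow (by linarith), Real.zero_rpow (by linarith)]
    simpa using Real.rpow_nonneg hz s
  · have h1 : -1 ≤ z / w - 1 := by
      have : 0 ≤ z / w := by positivity
      linarith
    have h2 := one_add_mul_self_le_rpow_one_add h1 hs.le
    have h3 : w ^ s = w ^ (s - 1) * w := by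
      rw [← Real.rpow_add_one hw.ne']; ring_nf
    have h4 : (1 + (z / w - 1)) ^ s = z ^ s / w ^ s := by
      rw [← Real.div_rpow hz hw.le]; ring_nf
    have hws : 0 < w ^ s := Real.rpow_pos_of_pos hw s
    rw [h4, le_div_iff₀ hws] at h2
    refine le_trans (le_of_eq ?_) h2
    rw [h3]
    field_simp

/-- `∫_u^y α (1 - t^(s-1)) e^(-α t) dt`. -/
noncomputable def priceIntegral (s u α y : ℝ) : ℝ :=
  ∫ t in u..y, α * (1 - t ^ (s - 1)) * Real.exp (-(α * t))

/-- The price curve that is `f'(y / u)` on `[0, u]` and solves `φ' = α (φ - f')` after `u`. -/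
noncomputable def priceCurve (a s u α y : ℝ) : ℝ :=
  if y ≤ u then a * s * (y / u) ^ (s - 1)
  else a * s * (1 + Real.exp (α * y) * priceIntegral s u α y)

/-- The antiderivative of `priceCurve`. -/
noncomputable def pricePotential (a s u α y : ℝ) : ℝ :=
  if y ≤ u then a * u * (y / u) ^ s
  else a * y ^ s + (a * s * (1 + Real.exp (α * y) * priceIntegral s u α y) - a) / α

/-- The rate in `priceCurve' = rate * (priceCurve - f')`. -/
noncomputable def priceRate (u α y : ℝ) : ℝ := if y < u then α * u / y else α

/-- The dual weight, with logarithmic derivative `-priceRate`. -/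
noncomputable def priceWeight (u α y : ℝ) : ℝ :=
  if y ≤ u then Real.exp (-(α * u)) * (y / u) ^ (-(α * u)) else Real.exp (-(α * y))

variable {a s u α : ℝ}

theorem continuous_integrand (hs : 1 < s) (α : ℝ) :
    Continuous fun t : ℝ => α * (1 - t ^ (s - 1)) * Real.exp (-(α * t)) := by
  have : Continuous fun t : ℝ => t ^ (s - 1) :=
    continuous_id.rpow_const fun _ => Or.inr (by linarith)
  fun_prop

theorem hasDerivAt_priceIntegral (hs : 1 < s) (u α y : ℝ) :
    HasDerivAt (priceIntegral s u α) (α * (1 - y ^ (s - 1)) * Real.exp (-(α * y))) y :=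
  (continuous_integrand hs α).integral_hasStrictDerivAt u y |>.hasDerivAt

theorem hasDerivAt_upperPrice (hs : 1 < s) (a u α y : ℝ) :
    HasDerivAt (fun y => a * s * (1 + Real.exp (α * y) * priceIntegral s u α y))
      (α * (a * s * (1 + Real.exp (α * y) * priceIntegral s u α y) - a * s * y ^ (s - 1))) y := by
  have h1 : HasDerivAt (fun y => Real.exp (α * y)) (Real.exp (α * y) * α) y := by
    simpa using ((hasDerivAt_id y).const_mul α).exp
  have h2 := ((h1.mul (hasDerivAt_priceIntegral hs u α y)).const_add 1).const_mul (a * s)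
  refine h2.congr_deriv ?_
  have h3 : Real.exp (α * y) * Real.exp (-(α * y)) = 1 := by rw [← Real.exp_add]; simp
  linear_combination a * s * α * (1 - y ^ (s - 1)) * h3

theorem priceIntegral_self (s u α : ℝ) : priceIntegral s u α u = 0 := by
  simp [priceIntegral]

theorem priceCurve_glue (hu : 0 < u) (a s α : ℝ) :
    a * s * (u / u) ^ (s - 1) = a * s * (1 + Real.exp (α * u) * priceIntegral s u α u) := by
  rw [priceIntegral_self, div_self hu.ne', Real.one_rpow]; ring

theorem rpow_eq_mul_rpow_sub_one {y : ℝ} (hs : 1 < s) (hy : 0 ≤ y) : y ^ s = y * y ^ (s - 1) := by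
  rcases hy.eq_or_lt with rfl | hy
  · rw [Real.zero_rpow (by linarith), zero_mul]
  · rw [Real.rpow_sub_one hy.ne']; field_simp

theorem priceCurve_of_le {y : ℝ} (hy : y ≤ u) :
    priceCurve a s u α y = a * s * (y / u) ^ (s - 1) := if_pos hy

theorem priceCurve_of_ge {y : ℝ} (hu : 0 < u) (hy : u ≤ y) :
    priceCurve a s u α y = a * s * (1 + Real.exp (α * y) * priceIntegral s u α y) := by
  unfold priceCurve
  split_ifs with h
  · rw [le_antisymm h hy, priceCurve_glue hu]
  · rfl

/-- Continuity of the potential at `u` is what ties `α` to `u`. -/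
theorem pricePotential_glue (hu : 0 < u) (hα : 0 < α) (hαu : α * (u - u ^ s) = s - 1) (a : ℝ) :
    a * u * (u / u) ^ s =
      a * u ^ s + (a * s * (1 + Real.exp (α * u) * priceIntegral s u α u) - a) / α := by
  rw [priceIntegral_self, div_self hu.ne', Real.one_rpow]
  field_simp
  linear_combination a * hαu

theorem pricePotential_of_le {y : ℝ} (hy : y ≤ u) :
    pricePotential a s u α y = a * u * (y / u) ^ s := if_pos hy

theorem pricePotential_of_ge {y : ℝ} (hu : 0 < u) (hα : 0 < α) (hαu : α * (u - u ^ s) = s - 1)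
    (hy : u ≤ y) :
    pricePotential a s u α y = a * y ^ s + (priceCurve a s u α y - a) / α := by
  rw [priceCurve_of_ge hu hy]
  unfold pricePotential
  split_ifs with h
  · rw [le_antisymm h hy, pricePotential_glue hu hα hαu]
  · rfl

theorem continuous_priceCurve (hs : 1 < s) (hu : 0 < u) (a α : ℝ) :
    Continuous (priceCurve a s u α) := by
  refine Continuous.if_le ?_ ?_ continuous_id continuous_const ?_
  · have : Continuous fun t : ℝ => (t / u) ^ (s - 1) :=
      (continuous_id.div_const u).rpow_const fun _ => Or.inr (by linarith)
    fun_prop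
  · exact continuous_iff_continuousAt.2 fun y => (hasDerivAt_upperPrice hs a u α y).continuousAt
  · rintro y rfl
    exact priceCurve_glue hu a s α

theorem continuous_pricePotential (hs : 1 < s) (hu : 0 < u) (hα : 0 < α)
    (hαu : α * (u - u ^ s) = s - 1) (a : ℝ) :
    Continuous (pricePotential a s u α) := by
  refine Continuous.if_le ?_ ?_ continuous_id continuous_const ?_
  · have : Continuous fun t : ℝ => (t / u) ^ s :=
      (continuous_id.div_const u).rpow_const fun _ => Or.inr (by linarith)
    fun_prop
  · have h1 : Continuous fun t : ℝ => t ^ s :=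
      continuous_id.rpow_const fun _ => Or.inr (by linarith)
    have h2 : Continuous fun y => a * s * (1 + Real.exp (α * y) * priceIntegral s u α y) :=
      continuous_iff_continuousAt.2 fun y => (hasDerivAt_upperPrice hs a u α y).continuousAt
    fun_prop
  · rintro y rfl
    exact pricePotential_glue hu hα hαu a

theorem u_mul_one_sub (hs : 1 < s) (hu : 0 < u) (hαu : α * (u - u ^ s) = s - 1) :
    α * u * (1 - u ^ (s - 1)) = s - 1 := by
  linear_combination hαu + α * rpow_eq_mul_rpow_sub_one hs hu.le

/-- Below `u`, `φ' = (s-1) φ / y` and `φ - f' = (1 - u^(s-1)) φ`, and `u_mul_one_sub` turns the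
quotient into the rate `α u / y`. -/
theorem hasDerivWithinAt_priceCurve (hs : 1 < s) (hu : 0 < u) (hαu : α * (u - u ^ s) = s - 1)
    (a : ℝ) {y : ℝ} (hy : 0 < y) :
    HasDerivWithinAt (priceCurve a s u α)
      (priceRate u α y * (priceCurve a s u α y - a * s * y ^ (s - 1))) (Ici y) y := by
  rcases lt_or_ge y u with hyu | hyu
  · refine hasDerivWithinAt_ite_of_lt hyu ?_
    have h1 := (((hasDerivAt_id y).div_const u).rpow_const (p := s - 1)
      (Or.inl (by simp only [id]; positivity))).const_mul (a * s)
    refine h1.congr_deriv ?_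
    have hyu0 : 0 < y / u := by positivity
    have h2 := u_mul_one_sub hs hu hαu
    simp only [id]
    rw [priceRate, if_pos hyu, priceCurve_of_le hyu.le, Real.rpow_sub_one hyu0.ne',
      Real.div_rpow hy.le hu.le]
    have h3 : 0 < u ^ (s - 1) := Real.rpow_pos_of_pos hu _
    field_simp
    linear_combination -a * h2
  · rw [priceRate, if_neg (not_lt.2 hyu), priceCurve_of_ge hu hyu]
    exact hasDerivWithinAt_ite_of_ge (priceCurve_glue hu a s α) hyu
      (hasDerivAt_upperPrice hs a u α y)

theorem hasDerivWithinAt_pricePotential (hs : 1 < s) (hu : 0 < u) (hα : 0 < α)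
    (hαu : α * (u - u ^ s) = s - 1) (a : ℝ) {y : ℝ} :
    HasDerivWithinAt (pricePotential a s u α) (priceCurve a s u α y) (Ici y) y := by
  rcases lt_or_ge y u with hyu | hyu
  · refine hasDerivWithinAt_ite_of_lt hyu ?_
    have h1 := (((hasDerivAt_id y).div_const u).rpow_const (p := s)
      (Or.inr hs.le)).const_mul (a * u)
    refine h1.congr_deriv ?_
    rw [priceCurve_of_le hyu.le]
    simp only [id]
    field_simp
  · rw [priceCurve_of_ge hu hyu]
    refine hasDerivWithinAt_ite_of_ge (pricePotential_glue hu hα hαu a) hyu ?_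
    have h1 := ((hasDerivAt_id y).rpow_const (p := s) (Or.inr hs.le)).const_mul a
    have h2 := h1.add (((hasDerivAt_upperPrice hs a u α y).sub_const a).div_const α)
    refine h2.congr_deriv ?_
    simp only [id]
    field_simp
    ring

theorem priceIntegral_nonneg {y : ℝ} (hs : 1 < s) (hu : 0 < u) (hα : 0 < α) (huy : u ≤ y) (hy : y ≤ 1) :
    0 ≤ priceIntegral s u α y := by
  refine intervalIntegral.integral_nonneg huy fun t ht => ?_
  have : t ^ (s - 1) ≤ 1 :=
    Real.rpow_le_one (hu.le.trans ht.1) (ht.2.trans hy) (by linarith)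
  exact mul_nonneg (mul_nonneg hα.le (by linarith)) (Real.exp_pos _).le

theorem le_priceCurve_of_ge {y : ℝ} (ha : 0 < a) (hs : 1 < s) (hu : 0 < u) (hα : 0 < α)
    (huy : u ≤ y) (hy : y ≤ 1) : a * s ≤ priceCurve a s u α y := by
  rw [priceCurve_of_ge hu huy]
  have := priceIntegral_nonneg hs hu hα huy hy
  refine le_mul_of_one_le_right (by positivity) ?_
  have : 0 ≤ Real.exp (α * y) * priceIntegral s u α y := by positivity
  linarith

theorem marginalCost_le_priceCurve {y : ℝ} (ha : 0 < a) (hs : 1 < s) (hu : 0 < u) (hu1 : u ≤ 1)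
    (hα : 0 < α) (hy0 : 0 ≤ y) (hy : y ≤ 1) : a * s * y ^ (s - 1) ≤ priceCurve a s u α y := by
  rcases le_total y u with hyu | hyu
  · rw [priceCurve_of_le hyu]
    refine mul_le_mul_of_nonneg_left ?_ (by positivity)
    refine Real.rpow_le_rpow hy0 ?_ (by linarith)
    rw [le_div_iff₀ hu]
    exact mul_le_of_le_one_right hy0 hu1
  · refine le_trans ?_ (le_priceCurve_of_ge ha hs hu hα hyu hy)
    exact mul_le_of_le_one_right (by positivity) (Real.rpow_le_one hy0 hy (by linarith))

theorem priceRate_pos {y : ℝ} (hu : 0 < u) (hα : 0 < α) (hy : 0 < y) : 0 < priceRate u α y := by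
  unfold priceRate
  split_ifs <;> positivity

theorem monotoneOn_priceCurve (ha : 0 < a) (hs : 1 < s) (hu : 0 < u) (hu1 : u ≤ 1) (hα : 0 < α)
    (hαu : α * (u - u ^ s) = s - 1) : MonotoneOn (priceCurve a s u α) (Icc 0 1) := by
  have h1 : MonotoneOn (priceCurve a s u α) (Icc 0 u) := by
    intro x hx y hy hxy
    rw [priceCurve_of_le hx.2, priceCurve_of_le hy.2]
    refine mul_le_mul_of_nonneg_left ?_ (by positivity)
    exact Real.rpow_le_rpow (div_nonneg hx.1 hu.le) (by gcongr) (by linarith)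
  have h2 : MonotoneOn (priceCurve a s u α) (Icc u 1) := by
    refine monotoneOn_of_right_deriv_nonneg (continuous_priceCurve hs hu a α).continuousOn
      (fun t ht => hasDerivWithinAt_priceCurve hs hu hαu a (hu.trans_le ht.1)) fun t ht => ?_
    refine mul_nonneg (priceRate_pos hu hα (hu.trans_le ht.1)).le ?_
    exact sub_nonneg.2 (marginalCost_le_priceCurve ha hs hu hu1 hα (hu.le.trans ht.1) ht.2.le)
  have h3 := h1.union_right h2 (isGreatest_Icc hu.le) (isLeast_Icc hu1)
  rwa [Icc_union_Icc_eq_Icc hu.le hu1] at h3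

theorem priceCurve_zero (hs : 1 < s) (hu : 0 < u) : priceCurve a s u α 0 = 0 := by
  rw [priceCurve_of_le hu.le, zero_div, Real.zero_rpow (by linarith), mul_zero]

theorem pricePotential_zero (hs : 1 < s) (hu : 0 < u) : pricePotential a s u α 0 = 0 := by
  rw [pricePotential_of_le hu.le, zero_div, Real.zero_rpow (by linarith), mul_zero]

theorem pricePotential_sub_le (ha : 0 < a) (hs : 1 < s) (hu : 0 < u) (hu1 : u ≤ 1) (hα : 0 < α)
    (hαu : α * (u - u ^ s) = s - 1) {x y : ℝ} (hx : 0 ≤ x) (hxy : x ≤ y) (hy : y ≤ 1) :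
    pricePotential a s u α y - pricePotential a s u α x ≤ (y - x) * priceCurve a s u α y := by
  have h := le_of_right_deriv_nonneg
    (W := fun t => t * priceCurve a s u α y - pricePotential a s u α t)
    (W' := fun t => 1 * priceCurve a s u α y - priceCurve a s u α t) hxy ?_ ?_ ?_
  · linarith
  · have := continuous_pricePotential hs hu hα hαu a
    fun_prop
  · intro t _
    exact ((hasDerivWithinAt_id t _).mul_const _).fun_sub
      (hasDerivWithinAt_pricePotential hs hu hα hαu a)
  · intro t ht
    have := monotoneOn_priceCurve ha hs hu hu1 hα hαu ⟨hx.trans ht.1, ht.2.le.trans hy⟩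
      ⟨hx.trans hxy, hy⟩ ht.2.le
    linarith

/-- The conjugate of the cost at the price `priceCurve y` is attained at `min (y / u) 1` and equals
`α (Φ(y) - f(y))`. -/
theorem priceCurve_conjugate_eq_of_le (hs : 1 < s) (hu : 0 < u)
    (hαu : α * (u - u ^ s) = s - 1) (a : ℝ) {y : ℝ} (hy : 0 ≤ y) (hyu : y ≤ u) :
    priceCurve a s u α y * (y / u) - powerCost a s (y / u) =
      α * (pricePotential a s u α y - powerCost a s y) := by
  have hyu0 : 0 ≤ y / u := by positivity
  have hu' : 0 < u ^ s := Real.rpow_pos_of_pos hu s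
  rw [priceCurve_of_le hyu, pricePotential_of_le hyu]
  have h1 := rpow_eq_mul_rpow_sub_one hs hyu0
  have h2 : y ^ s = u ^ s * (y / u) ^ s := by
    rw [← Real.mul_rpow hu.le hyu0]; congr 1; field_simp
  unfold powerCost
  rw [h2]
  linear_combination (-a * s) * h1 - a * (y / u) ^ s * hαu

theorem priceCurve_conjugate_eq_of_ge (hu : 0 < u) (hα : 0 < α)
    (hαu : α * (u - u ^ s) = s - 1) (a : ℝ) {y : ℝ} (hyu : u ≤ y) :
    priceCurve a s u α y * 1 - powerCost a s 1 =
      α * (pricePotential a s u α y - powerCost a s y) := by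
  rw [pricePotential_of_ge hu hα hαu hyu, powerCost, powerCost, Real.one_rpow]
  field_simp
  ring

/-- Convexity: the tangent of the cost at the maximizer, which is `y / u` below `u` and the capacity
`1` above, where the price is at least `f'(1)`. -/
theorem priceCurve_dual_le (ha : 0 < a) (hs : 1 < s) (hu : 0 < u) (hα : 0 < α)
    (hαu : α * (u - u ^ s) = s - 1) {y z : ℝ} (hy : y ∈ Icc (0 : ℝ) 1) (hz : z ∈ Icc (0 : ℝ) 1) :
    priceCurve a s u α y * z - powerCost a s z ≤
      α * (pricePotential a s u α y - powerCost a s y) := by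
  rcases le_total y u with hyu | hyu
  · rw [← priceCurve_conjugate_eq_of_le hs hu hαu a hy.1 hyu, priceCurve_of_le hyu, powerCost,
      powerCost]
    have := mul_le_mul_of_nonneg_left
      (rpow_tangent_le hs (div_nonneg hy.1 hu.le : 0 ≤ y / u) hz.1) ha.le
    linarith
  · rw [← priceCurve_conjugate_eq_of_ge hu hα hαu a hyu, powerCost, powerCost]
    have h1 := mul_le_mul_of_nonneg_left (rpow_tangent_le hs zero_le_one hz.1) ha.le
    rw [Real.one_rpow, Real.one_rpow] at h1
    rw [Real.one_rpow]
    have h2 := mul_le_mul_of_nonneg_right (le_priceCurve_of_ge ha hs hu hα hyu hy.2)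
      (sub_nonneg.2 hz.2)
    linarith

theorem priceWeight_glue (hu : 0 < u) :
    Real.exp (-(α * u)) * (u / u) ^ (-(α * u)) = Real.exp (-(α * u)) := by
  rw [div_self hu.ne', Real.one_rpow, mul_one]

theorem priceWeight_pos {y : ℝ} (hu : 0 < u) (hy : 0 < y) : 0 < priceWeight u α y := by
  unfold priceWeight
  split_ifs <;> positivity

theorem continuousOn_priceWeight (hu : 0 < u) : ContinuousOn (priceWeight u α) (Ioi 0) := by
  have h : ContinuousOn (fun y => if y ≤ u then
      Real.exp (-(α * u)) * (y / u) ^ (-(α * u)) else Real.exp (-(α * y))) (Ioi 0) := by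
    refine ContinuousOn.if ?_ ?_ ?_
    · rintro y ⟨-, hy⟩
      have hy' : y = u := by
        have := frontier_le_subset_eq continuous_id continuous_const hy
        simpa using this
      rw [hy', priceWeight_glue hu]
    · refine continuousOn_const.mul (ContinuousOn.rpow_const (by fun_prop) fun y hy => Or.inl ?_)
      have : 0 < y := hy.1
      positivity
    · fun_prop
  exact h

theorem hasDerivWithinAt_priceWeight (hu : 0 < u) {y : ℝ} (hy : 0 < y) :
    HasDerivWithinAt (priceWeight u α) (-(priceRate u α y * priceWeight u α y)) (Ici y) y := by
  rcases lt_or_ge y u with hyu | hyu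
  · refine hasDerivWithinAt_ite_of_lt hyu ?_
    have h1 := (((hasDerivAt_id y).div_const u).rpow_const (p := -(α * u))
      (Or.inl (by simp only [id]; positivity))).const_mul (Real.exp (-(α * u)))
    refine h1.congr_deriv ?_
    have hyu0 : 0 < y / u := by positivity
    simp only [id]
    rw [priceRate, if_pos hyu, priceWeight, if_pos hyu.le, Real.rpow_sub_one hyu0.ne']
    field_simp
  · have h2 : priceWeight u α y = Real.exp (-(α * y)) := by
      unfold priceWeight
      split_ifs with h
      · rw [le_antisymm h hyu, priceWeight_glue hu]
      · rfl
    rw [priceRate, if_neg (not_lt.2 hyu), h2]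
    refine hasDerivWithinAt_ite_of_ge (priceWeight_glue hu) hyu ?_
    have h3 := ((hasDerivAt_id y).const_mul α).fun_neg.exp
    refine h3.congr_deriv ?_
    simp only [id]
    ring

end PowerCurve

/-! ### No sales curve has a ratio below `α`. -/

section LowerBounds

open Set Filter Topology

variable {a s u α pbar β δ y : ℝ} {x Q : ℝ → ℝ}

/-- The integral of the utilization along the price curve. -/
noncomputable def priceRent (a s u α y : ℝ) : ℝ :=
  y * priceCurve a s u α y - pricePotential a s u α y

/-- The conjugate of the cost at the price `priceCurve y`. -/
noncomputable def priceConjugate (a s u α y : ℝ) : ℝ :=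
  α * (pricePotential a s u α y - powerCost a s y)

theorem powerCost_zero (hs : 1 < s) : powerCost a s 0 = 0 := by
  rw [powerCost, Real.zero_rpow (by linarith), mul_zero]

theorem powerCost_monotoneOn (ha : 0 < a) (hs : 1 < s) : MonotoneOn (powerCost a s) (Icc 0 1) :=
  fun _ hx _ _ hxy => mul_le_mul_of_nonneg_left (Real.rpow_le_rpow hx.1 hxy (by linarith)) ha.le

theorem hasDerivWithinAt_priceRent (hs : 1 < s) (hu : 0 < u) (hα : 0 < α)
    (hαu : α * (u - u ^ s) = s - 1) (a : ℝ) (hy : 0 < y) :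
    HasDerivWithinAt (priceRent a s u α)
      (y * (priceRate u α y * (priceCurve a s u α y - a * s * y ^ (s - 1)))) (Ici y) y := by
  have h := ((hasDerivWithinAt_id y (Ici y)).fun_mul
    (hasDerivWithinAt_priceCurve hs hu hαu a hy)).fun_sub
    (hasDerivWithinAt_pricePotential hs hu hα hαu a)
  refine h.congr_deriv ?_
  simp only [id]
  ring

theorem continuous_priceRent (hs : 1 < s) (hu : 0 < u) (hα : 0 < α)
    (hαu : α * (u - u ^ s) = s - 1) (a : ℝ) : Continuous (priceRent a s u α) :=
  (continuous_id.mul (continuous_priceCurve hs hu a α)).sub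
    (continuous_pricePotential hs hu hα hαu a)

theorem priceConjugate_nonneg (ha : 0 < a) (hs : 1 < s) (hu : 0 < u) (hα : 0 < α)
    (hαu : α * (u - u ^ s) = s - 1) (hy : y ∈ Icc (0 : ℝ) 1) : 0 ≤ priceConjugate a s u α y := by
  have := priceCurve_dual_le ha hs hu hα hαu hy (z := 0) ⟨le_rfl, zero_le_one⟩
  rw [powerCost_zero hs] at this
  rw [priceConjugate]
  simpa using this

theorem priceCurve_nonneg (ha : 0 < a) (hs : 1 < s) (hu : 0 < u) (hu1 : u ≤ 1) (hα : 0 < α)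
    (hαu : α * (u - u ^ s) = s - 1) (hy : y ∈ Icc (0 : ℝ) 1) : 0 ≤ priceCurve a s u α y := by
  rw [← priceCurve_zero (a := a) (α := α) hs hu]
  exact monotoneOn_priceCurve ha hs hu hu1 hα hαu ⟨le_rfl, zero_le_one⟩ hy hy.1

/-- The profit condition of a sales curve at the price `priceCurve y`. -/
theorem IsSalesCurve.conjugate_le (h : IsSalesCurve (powerCost a s) pbar β δ x Q)
    (ha : 0 < a) (hs : 1 < s) (hu : 0 < u) (hu1 : u ≤ 1) (hα : 0 < α)
    (hαu : α * (u - u ^ s) = s - 1) (hy : y ∈ Icc (0 : ℝ) 1) (hyp : priceCurve a s u α y ≤ pbar) :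
    priceConjugate a s u α y / β - δ ≤ priceCurve a s u α y * x (priceCurve a s u α y) -
      powerCost a s (x (priceCurve a s u α y)) - Q (priceCurve a s u α y) := by
  have hp : priceCurve a s u α y ∈ Icc 0 pbar := ⟨priceCurve_nonneg ha hs hu hu1 hα hαu hy, hyp⟩
  rcases le_total y u with hyu | hyu
  · rw [priceConjugate, ← priceCurve_conjugate_eq_of_le hs hu hαu a hy.1 hyu]
    exact h.profit _ hp _ ⟨div_nonneg hy.1 hu.le, (div_le_one hu).2 hyu⟩
  · rw [priceConjugate, ← priceCurve_conjugate_eq_of_ge hu hα hαu a hyu]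
    exact h.profit _ hp _ ⟨zero_le_one, le_rfl⟩

/-- The accumulated gain of a sales curve with a ratio `β < α` over the price curve is bounded by
boundary terms. -/
theorem IsSalesCurve.gain_le (h : IsSalesCurve (powerCost a s) pbar β δ x Q)
    (ha : 0 < a) (hs : 1 < s) (hu : 0 < u) (hu1 : u ≤ 1) (hα : 0 < α)
    (hαu : α * (u - u ^ s) = s - 1) {y₀ y₁ : ℝ} (hy₀ : 0 < y₀) (hy : y₀ ≤ y₁) (hy₁ : y₁ ≤ 1)
    (hyp : priceCurve a s u α y₁ ≤ pbar) {E e : ℝ → ℝ} (hE : ContinuousOn E (Icc y₀ y₁))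
    (hEd : ∀ y ∈ Ico y₀ y₁, HasDerivWithinAt E (e y) (Ici y) y)
    (hgain : ∀ y ∈ Ico y₀ y₁, e y ≤ priceRate u α y * priceWeight u α y *
      (priceConjugate a s u α y * (1 / β - 1 / α))) :
    E y₁ - E y₀ ≤ priceWeight u α y₀ * (priceRent a s u α y₀ + δ) +
      priceWeight u α y₁ * (priceConjugate a s u α y₁ * (1 - 1 / β) - priceRent a s u α y₁) := by
  have hmono := monotoneOn_priceCurve ha hs hu hu1 hα hαu
  have hmem : ∀ y ∈ Icc y₀ y₁, y ∈ Icc (0 : ℝ) 1 := fun y hy =>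
    ⟨hy₀.le.trans hy.1, hy.2.trans hy₁⟩
  have hle : ∀ y ∈ Icc y₀ y₁, priceCurve a s u α y ≤ pbar := fun y hyy =>
    (hmono (hmem y hyy) (hmem y₁ ⟨hy, le_rfl⟩) hyy.2).trans hyp
  have hpos : ∀ y ∈ Ico y₀ y₁, 0 < y := fun y hy => hy₀.trans_le hy.1
  have key := weighted_excess_le (f := powerCost a s) (fd := fun y => a * s * y ^ (s - 1))
    (φ := priceCurve a s u α) (R := priceRent a s u α) (M := priceWeight u α)
    (r := priceRate u α) (g := fun y => priceConjugate a s u α y * (1 / β - 1 / α))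
    (x := x) (Q := Q) (δ := δ) hy
    (continuous_priceCurve hs hu a α).continuousOn
    (hmono.mono fun y hy => hmem y hy)
    (fun y hy => hasDerivWithinAt_priceCurve hs hu hαu a (hpos y hy))
    (continuous_priceRent hs hu hα hαu a).continuousOn
    (fun y hy => hasDerivWithinAt_priceRent hs hu hα hαu a (hpos y hy))
    ((continuousOn_priceWeight hu).mono fun y hy => hy₀.trans_le hy.1)
    (fun y hy => hasDerivWithinAt_priceWeight hu (hpos y hy))
    hE hEd h.continuous h.hasDeriv
    (fun y hy => (priceWeight_pos hu (hpos y hy)).le)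
    (fun y hy => (priceRate_pos hu hα (hpos y hy)).le)
    (fun y hy => rfl)
    (fun y hy => ?_) (fun y hy => ?_) hgain
  · have hc := h.conjugate_le ha hs hu hu1 hα hαu (hmem y₁ ⟨hy, le_rfl⟩) hyp
    have hd := priceCurve_dual_le ha hs hu hα hαu (hmem y₁ ⟨hy, le_rfl⟩)
      (h.mem_Icc (priceCurve a s u α y₁))
    have hM1 := priceWeight_pos (α := α) hu (hy₀.trans_le hy)
    have hM0 := priceWeight_pos (α := α) hu hy₀
    have h0 : 0 ≤ priceWeight u α y₀ * Q (priceCurve a s u α y₀) :=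
      mul_nonneg hM0.le (h.nonneg _)
    -- Profit before subtracting `Q` is at most the conjugate, yet profit after it must be at least
    -- the conjugate over `β`, less `δ`.
    have hQ : Q (priceCurve a s u α y₁) ≤ priceConjugate a s u α y₁ * (1 - 1 / β) + δ := by
      have : priceConjugate a s u α y₁ * (1 - 1 / β) =
        priceConjugate a s u α y₁ - priceConjugate a s u α y₁ / β := by ring
      rw [this]
      unfold priceConjugate at hc ⊢
      linarith
    have h1 := mul_le_mul_of_nonneg_left hQ hM1.le
    linarith
  · have := mul_le_mul_of_nonneg_left
      (rpow_tangent_le hs (hpos y hy).le (h.mem_Icc (priceCurve a s u α y)).1) ha.le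
    unfold powerCost
    linarith
  · have hc := h.conjugate_le ha hs hu hu1 hα hαu (hmem y ⟨hy.1, hy.2.le⟩)
      (hle y ⟨hy.1, hy.2.le⟩)
    refine le_trans (le_of_eq ?_) hc
    have : pricePotential a s u α y - powerCost a s y = priceConjugate a s u α y / α := by
      rw [priceConjugate]; field_simp
    rw [priceRent]
    linear_combination this

theorem priceRent_of_le (hs : 1 < s) (hu : 0 < u) (hy : 0 ≤ y) (hyu : y ≤ u) :
    priceRent a s u α y = a * u * (s - 1) * (y / u) ^ s := by
  rw [priceRent, priceCurve_of_le hyu, pricePotential_of_le hyu,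
    rpow_eq_mul_rpow_sub_one hs (by positivity : 0 ≤ y / u)]
  field_simp

theorem priceConjugate_of_le (hs : 1 < s) (hu : 0 < u)
    (hαu : α * (u - u ^ s) = s - 1) (hy : 0 ≤ y) (hyu : y ≤ u) :
    priceConjugate a s u α y = a * (s - 1) * (y / u) ^ s := by
  rw [priceConjugate, ← priceCurve_conjugate_eq_of_le hs hu hαu a hy hyu, priceCurve_of_le hyu,
    powerCost, rpow_eq_mul_rpow_sub_one hs (by positivity : 0 ≤ y / u)]
  ring

/-- Rent and conjugate are multiples of `(y/u)^s` on `(0,u]`, so their weighted versions are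
constant if `αu = s` and vanish at `0` if `αu < s`. -/
theorem priceWeight_mul_rpow (hu : 0 < u) (hy : 0 < y) (hyu : y ≤ u) :
    priceWeight u α y * (y / u) ^ s = Real.exp (-(α * u)) * (y / u) ^ (s - α * u) := by
  have hyu0 : 0 < y / u := by positivity
  rw [priceWeight, if_pos hyu, mul_assoc, ← Real.rpow_add hyu0]
  ring_nf

/-- No sales curve beats the ratio `α` whose price curve has scale-invariant dual weights. -/
theorem exists_no_salesCurve_of_critical (ha : 0 < a) (hs : 1 < s) (hu : 0 < u) (hu1 : u ≤ 1)
    (hα : 0 < α) (hαu : α * (u - u ^ s) = s - 1) (hcrit : α * u = s) (hp : 0 < pbar)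
    (hβ : 1 ≤ β) (hβα : β < α) :
    ∃ δ : ℝ, 0 < δ ∧ ∀ x Q, ¬ IsSalesCurve (powerCost a s) pbar β δ x Q := by
  have hβ0 : 0 < β := by linarith
  -- Only prices near zero are used, so any positive `pbar` suffices.
  obtain ⟨y₁, hy₁p, hy₁⟩ : ∃ y₁, priceCurve a s u α y₁ < pbar ∧ y₁ ∈ Ioo 0 u := by
    have h1 : ∀ᶠ y in 𝓝[>] (0 : ℝ), priceCurve a s u α y < pbar := by
      have := (continuous_priceCurve hs hu a α).continuousAt (x := 0)
      refine (this.eventually_lt continuousAt_const ?_).filter_mono nhdsWithin_le_nhds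
      rwa [priceCurve_zero hs hu]
    exact (h1.and (Ioo_mem_nhdsGT hu)).exists
  have hη : 0 < 1 / β - 1 / α := sub_pos.2 (one_div_lt_one_div_of_lt hβ0 hβα)
  set η := 1 / β - 1 / α with hηdef
  set k₁ := Real.exp (-(α * u)) * (a * u * (s - 1)) with hk₁
  set k₂ := Real.exp (-(α * u)) * (a * (s - 1)) with hk₂
  have hs1 : 0 < s - 1 := by linarith
  have hk₁0 : 0 < k₁ := by positivity
  have hk₂0 : 0 < k₂ := by positivity
  -- Between `y₀ = y₁ e^(-L)` and `y₁` the logarithmic gain is `k₁ + k₂ + 2`, while the boundary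
  -- terms stay below `k₂ + 1` once `δ` times the weight at `y₀` is `1`.
  set L := (k₁ + k₂ + 2) / (η * s * k₂) with hL
  have hL0 : 0 < L := by positivity
  have hy₁0 := hy₁.1
  set y₀ := y₁ * Real.exp (-L) with hy₀
  have hy₀0 : 0 < y₀ := by positivity
  have hy₀₁ : y₀ ≤ y₁ :=
    mul_le_of_le_one_right hy₁0.le (Real.exp_le_one_iff.2 (by linarith))
  have hM₀ := priceWeight_pos (α := α) hu hy₀0
  refine ⟨1 / priceWeight u α y₀, by positivity, fun x Q h => ?_⟩
  have hMF : ∀ y, 0 < y → y ≤ u → priceWeight u α y * priceConjugate a s u α y = k₂ := by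
    intro y hy hyu
    have h1 := priceWeight_mul_rpow (α := α) (s := s) hu hy hyu
    rw [hcrit, sub_self, Real.rpow_zero, ← hcrit] at h1
    rw [priceConjugate_of_le hs hu hαu hy.le hyu, hk₂]
    rw [hcrit] at h1 ⊢
    linear_combination a * (s - 1) * h1
  have hMR : ∀ y, 0 < y → y ≤ u → priceWeight u α y * priceRent a s u α y = k₁ := by
    intro y hy hyu
    have h1 := priceWeight_mul_rpow (α := α) (s := s) hu hy hyu
    rw [hcrit, sub_self, Real.rpow_zero, ← hcrit] at h1
    rw [priceRent_of_le hs hu hy.le hyu, hk₁]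
    rw [hcrit] at h1 ⊢
    linear_combination a * u * (s - 1) * h1
  have hg := h.gain_le ha hs hu hu1 hα hαu hy₀0 hy₀₁ (hy₁.2.le.trans hu1) hy₁p.le
    (E := fun y => η * s * k₂ * Real.log y) (e := fun y => η * s * k₂ * y⁻¹) ?_ ?_ ?_
  · have h1 := hMF y₁ hy₁0 hy₁.2.le
    have h2 := hMR y₁ hy₁0 hy₁.2.le
    have h3 := hMR y₀ hy₀0 (hy₀₁.trans hy₁.2.le)
    have h4 : Real.log y₀ = Real.log y₁ - L := by
      rw [hy₀, Real.log_mul hy₁0.ne' (Real.exp_pos _).ne', Real.log_exp]; ring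
    have h5 : η * s * k₂ * L = k₁ + k₂ + 2 := by rw [hL]; field_simp
    have h6 : priceWeight u α y₀ * (1 / priceWeight u α y₀) = 1 := by field_simp
    have h7 : 0 ≤ k₂ * (1 / β) := by positivity
    have h8 : priceWeight u α y₁ * (priceConjugate a s u α y₁ * (1 - 1 / β) -
        priceRent a s u α y₁) = k₂ * (1 - 1 / β) - k₁ := by
      rw [← h1, ← h2]; ring
    rw [h8, mul_add, h3, h6] at hg
    simp only [h4] at hg
    linarith
  · refine ContinuousOn.const_smul (ContinuousOn.log continuousOn_id fun y hy => ?_) (η * s * k₂)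
    exact (hy₀0.trans_le hy.1).ne'
  · intro y hy
    exact ((Real.hasDerivAt_log (hy₀0.trans_le hy.1).ne').const_mul _).hasDerivWithinAt
  · intro y hy
    have hyu : y < u := hy.2.trans hy₁.2
    have hy0 := hy₀0.trans_le hy.1
    rw [priceRate, if_pos hyu, hcrit, ← hMF y hy0 hyu.le]
    rw [← hηdef]
    refine le_of_eq ?_
    ring

/-- No sales curve for prices up to the end of the price curve beats its ratio `α`. -/
theorem exists_no_salesCurve_of_subcritical (ha : 0 < a) (hs : 1 < s) (hu : 0 < u) (hu1 : u ≤ 1)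
    (hα : 0 < α) (hαu : α * (u - u ^ s) = s - 1) (hsub : α * u < s)
    (hp : priceCurve a s u α 1 ≤ pbar) (hβ : 1 ≤ β) (hβα : β < α) :
    ∃ δ : ℝ, 0 < δ ∧ ∀ x Q, ¬ IsSalesCurve (powerCost a s) pbar β δ x Q := by
  have hβ0 : 0 < β := by linarith
  have hη : 0 < 1 / β - 1 / α := sub_pos.2 (one_div_lt_one_div_of_lt hβ0 hβα)
  set η := 1 / β - 1 / α with hηdef
  have hF1 : 0 < priceConjugate a s u α 1 := by
    rw [priceConjugate, ← priceCurve_conjugate_eq_of_ge hu hα hαu a hu1, powerCost, Real.one_rpow]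
    have := le_priceCurve_of_ge ha hs hu hα hu1 le_rfl
    have : a * 1 < a * s := mul_lt_mul_of_pos_left hs ha
    linarith
  -- Hence the boundary term at `y = 1` is exactly `-G`. The rent at `y₀` and the `δ` term get less
  -- than `G / 2` and exactly `G / 2`.
  have hR1 : priceRent a s u α 1 = priceConjugate a s u α 1 * (1 - 1 / α) := by
    have h1 : priceConjugate a s u α 1 / α = pricePotential a s u α 1 - powerCost a s 1 := by
      rw [priceConjugate]; field_simp
    have h2 : priceCurve a s u α 1 * 1 - powerCost a s 1 = priceConjugate a s u α 1 :=
      priceCurve_conjugate_eq_of_ge hu hα hαu a hu1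
    rw [priceRent]
    linear_combination h2 + h1
  have hM1 := priceWeight_pos (α := α) hu one_pos
  set G := priceWeight u α 1 * priceConjugate a s u α 1 * η with hG
  have hG0 : 0 < G := by positivity
  obtain ⟨y₀, hy₀small, hy₀⟩ : ∃ y₀,
      Real.exp (-(α * u)) * (a * u * (s - 1)) * (y₀ / u) ^ (s - α * u) < G / 2 ∧ y₀ ∈ Ioo 0 u := by
    have h1 : ∀ᶠ y in 𝓝[>] (0 : ℝ),
        Real.exp (-(α * u)) * (a * u * (s - 1)) * (y / u) ^ (s - α * u) < G / 2 := by
      have hc : Continuous fun y : ℝ =>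
          Real.exp (-(α * u)) * (a * u * (s - 1)) * (y / u) ^ (s - α * u) :=
        continuous_const.mul ((continuous_id.div_const u).rpow_const fun _ => Or.inr (by linarith))
      refine (hc.continuousAt.eventually_lt continuousAt_const ?_).filter_mono nhdsWithin_le_nhds
      rw [zero_div, Real.zero_rpow (by linarith), mul_zero]
      positivity
    exact (h1.and (Ioo_mem_nhdsGT hu)).exists
  have hM₀ := priceWeight_pos (α := α) hu hy₀.1
  refine ⟨G / 2 / priceWeight u α y₀, by positivity, fun x Q h => ?_⟩
  have hg := h.gain_le ha hs hu hu1 hα hαu hy₀.1 (hy₀.2.le.trans hu1) le_rfl hp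
    (E := fun _ => 0) (e := fun _ => 0) continuousOn_const
    (fun y _ => hasDerivWithinAt_const y _ _) ?_
  · have h1 : priceWeight u α y₀ * priceRent a s u α y₀ < G / 2 := by
      rw [priceRent_of_le hs hu hy₀.1.le hy₀.2.le]
      have h2 := priceWeight_mul_rpow (α := α) (s := s) hu hy₀.1 hy₀.2.le
      refine lt_of_eq_of_lt ?_ hy₀small
      linear_combination a * u * (s - 1) * h2
    have h3 : priceWeight u α y₀ * (G / 2 / priceWeight u α y₀) = G / 2 := by field_simp
    rw [hR1, mul_add, h3] at hg
    have h4 : priceWeight u α 1 * (priceConjugate a s u α 1 * (1 - 1 / β) -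
        priceConjugate a s u α 1 * (1 - 1 / α)) = -G := by rw [hG, hηdef]; ring
    rw [h4] at hg
    linarith
  · intro y hy
    have hy0 := hy₀.1.trans_le hy.1
    have h1 := priceConjugate_nonneg ha hs hu hα hαu ⟨hy0.le, hy.2.le⟩
    have h2 := (priceRate_pos hu hα hy0).le
    have h3 := (priceWeight_pos (α := α) hu hy0).le
    positivity

end LowerBounds

/-! ### The critical dividing threshold. -/

section Threshold

open Set Filter Topology

variable {a s u v α pbar : ℝ}

theorem uS_pos (hs : 1 < s) : 0 < uS s := Real.rpow_pos_of_pos (by positivity) _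

theorem uS_rpow (hs : 1 < s) : uS s ^ (s - 1) = 1 / s := by
  have : s - 1 ≠ 0 := by linarith
  rw [uS, ← Real.rpow_mul (by positivity), one_div_mul_cancel this, Real.rpow_one]

theorem uS_lt_one (hs : 1 < s) : uS s < 1 := by
  refine Real.rpow_lt_one (by positivity) ?_ (by rw [one_div_pos]; linarith)
  rw [div_lt_one (by linarith)]
  exact hs

theorem sub_rpow_pos (hs : 1 < s) (hu : 0 < u) (hu1 : u < 1) : 0 < u - u ^ s := by
  have := Real.rpow_lt_rpow_of_exponent_gt hu hu1 hs
  rw [Real.rpow_one] at this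
  linarith

theorem alphaS_mul (hs : 1 < s) (hu : 0 < u) (hu1 : u < 1) :
    alphaS s u * (u - u ^ s) = s - 1 :=
  div_mul_cancel₀ _ (sub_rpow_pos hs hu hu1).ne'

theorem alphaS_pos (hs : 1 < s) (hu : 0 < u) (hu1 : u < 1) : 0 < alphaS s u :=
  div_pos (by linarith) (sub_rpow_pos hs hu hu1)

theorem one_le_alphaS (hs : 1 < s) (hu : 0 < u) (hu1 : u < 1) : 1 ≤ alphaS s u := by
  rw [alphaS, one_le_div (sub_rpow_pos hs hu hu1)]
  have h := rpow_tangent_le hs zero_le_one hu.le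
  rw [Real.one_rpow, Real.one_rpow] at h
  have : 0 < (s - 1) * u := mul_pos (by linarith) hu
  linarith

theorem alphaMin_mul_uS (hs : 1 < s) : alphaMin s * uS s = s := by
  have hs0 : 0 < s := by linarith
  have hs1 : s - 1 ≠ 0 := by linarith
  rw [alphaMin, uS, one_div, Real.inv_rpow hs0.le, ← div_eq_mul_inv, ← Real.rpow_sub hs0]
  have : s / (s - 1) - 1 / (s - 1) = 1 := by field_simp
  rw [this, Real.rpow_one]

theorem alphaMin_rpow (hs : 1 < s) : alphaMin s ^ (s - 1) = s ^ s := by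
  have hs1 : s - 1 ≠ 0 := by linarith
  rw [alphaMin, ← Real.rpow_mul (by linarith), div_mul_cancel₀ _ hs1]

theorem alphaS_uS (hs : 1 < s) : alphaS s (uS s) = alphaMin s := by
  rw [alphaS, div_eq_iff (sub_rpow_pos hs (uS_pos hs) (uS_lt_one hs)).ne',
    rpow_eq_mul_rpow_sub_one hs (uS_pos hs).le, uS_rpow hs]
  have h := alphaMin_mul_uS hs
  have hs0 : s ≠ 0 := by linarith
  have h2 : s * (1 / s) = 1 := by field_simp
  linear_combination h2 - (1 - 1 / s) * h

/-- Thresholds below `u_s` are subcritical: `αu (1 - u^(s-1)) = s - 1` with `u^(s-1) < 1/s`. -/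
theorem alphaS_mul_lt (hs : 1 < s) (hu : 0 < u) (huS : u < uS s) : alphaS s u * u < s := by
  have hu1 := huS.trans (uS_lt_one hs)
  have h1 := u_mul_one_sub hs hu (alphaS_mul hs hu hu1)
  have h2 : u ^ (s - 1) < 1 / s := by
    rw [← uS_rpow hs]
    exact Real.rpow_lt_rpow hu.le huS (by linarith)
  have hpos : 0 < alphaS s u * u := mul_pos (alphaS_pos hs hu hu1) hu
  have h3 : alphaS s u * u * (1 - 1 / s) < s - 1 := by
    rw [← h1]
    exact mul_lt_mul_of_pos_left (by linarith) hpos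
  have h4 : s * (1 - 1 / s) = s - 1 := by field_simp
  rw [← h4] at h3
  refine lt_of_mul_lt_mul_right h3 ?_
  rw [sub_nonneg, div_le_one (by linarith)]
  exact hs.le

/-- The concave function `u - u^s` has nonnegative slope at `v ≤ u_s`; its tangent there gives the
comparison of denominators. -/
theorem alphaS_antitone (hs : 1 < s) (hu : 0 < u) (huv : u ≤ v) (hv : v ≤ uS s) :
    alphaS s v ≤ alphaS s u := by
  have hu1 : u < 1 := (huv.trans hv).trans_lt (uS_lt_one hs)
  refine div_le_div_of_nonneg_left (by linarith) (sub_rpow_pos hs hu hu1) ?_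
  have hv0 : 0 ≤ v := hu.le.trans huv
  have h1 := rpow_tangent_le hs hv0 hu.le
  have h2 : v ^ (s - 1) ≤ 1 / s := by
    rw [← uS_rpow hs]
    exact Real.rpow_le_rpow hv0 hv (by linarith)
  have h3 : s * v ^ (s - 1) ≤ 1 := by
    rw [le_div_iff₀ (by linarith)] at h2
    linarith
  have h4 := mul_le_mul_of_nonneg_right h3 (sub_nonneg.2 huv)
  linarith

theorem alphaOne_of_le (hs : 1 < s) (hu : u ≤ uS s) : alphaOne s u = alphaS s u := by
  unfold alphaOne
  split_ifs with h
  · rfl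
  · rw [le_antisymm hu (not_lt.1 h), alphaS_uS hs]

theorem alphaOne_antitone (hs : 1 < s) (hu : 0 < u) (huv : u ≤ v) :
    alphaOne s v ≤ alphaOne s u := by
  rcases le_total v (uS s) with hv | hv
  · rw [alphaOne_of_le hs hv, alphaOne_of_le hs (huv.trans hv)]
    exact alphaS_antitone hs hu huv hv
  · have h1 : alphaOne s v = alphaMin s := if_neg (not_lt.2 hv)
    rw [h1]
    rcases le_total u (uS s) with h | h
    · rw [alphaOne_of_le hs h, ← alphaS_uS hs]
      exact alphaS_antitone hs hu h le_rfl
    · exact (if_neg (not_lt.2 h)).ge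

theorem alphaOne_pos (hs : 1 < s) (hu : 0 < u) : 0 < alphaOne s u := by
  unfold alphaOne
  split_ifs with h
  · exact alphaS_pos hs hu (h.trans (uS_lt_one hs))
  · exact Real.rpow_pos_of_pos (by linarith) _

/-- The substitution `η = α t` links the threshold equation and `C_s` to the price curve. -/
theorem integral_rpow_mul_exp (hs : 1 < s) (hu : 0 ≤ u) (hu1 : u ≤ 1) (hα : 0 < α) :
    ∫ η in (u * α)..α, η ^ (s - 1) * Real.exp (-η) =
      α ^ (s - 1) * (Real.exp (-(α * u)) - Real.exp (-α) - priceIntegral s u α 1) := by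
  have hcr : Continuous fun t : ℝ => t ^ (s - 1) :=
    continuous_id.rpow_const fun _ => Or.inr (by linarith)
  have h1 : ∫ t in u..1, α * Real.exp (-(α * t)) = Real.exp (-(α * u)) - Real.exp (-α) := by
    have hd : ∀ t ∈ uIcc u 1, HasDerivAt (fun t => -Real.exp (-(α * t)))
        (α * Real.exp (-(α * t))) t := by
      intro t _
      refine ((hasDerivAt_id t).const_mul α).fun_neg.exp.fun_neg.congr_deriv ?_
      simp only [id]
      ring
    rw [intervalIntegral.integral_eq_sub_of_hasDerivAt hd
      (Continuous.intervalIntegrable (by fun_prop) _ _)]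
    rw [mul_one]
    ring
  have h2 : priceIntegral s u α 1 = (∫ t in u..1, α * Real.exp (-(α * t))) -
      ∫ t in u..1, α * (t ^ (s - 1) * Real.exp (-(α * t))) := by
    rw [priceIntegral, ← intervalIntegral.integral_sub
      (Continuous.intervalIntegrable (by fun_prop) _ _)
      (Continuous.intervalIntegrable (by fun_prop) _ _)]
    refine intervalIntegral.integral_congr fun t _ => ?_
    ring
  have h3 : ∫ η in (u * α)..α, η ^ (s - 1) * Real.exp (-η) =
      α ^ (s - 1) * ∫ t in u..1, α * (t ^ (s - 1) * Real.exp (-(α * t))) := by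
    have h4 := intervalIntegral.mul_integral_comp_mul_left (a := u) (b := 1)
      (f := fun η : ℝ => η ^ (s - 1) * Real.exp (-η)) α
    rw [mul_one, mul_comm α u] at h4
    rw [← h4, ← intervalIntegral.integral_const_mul, ← intervalIntegral.integral_const_mul]
    refine intervalIntegral.integral_congr fun t ht => ?_
    rw [uIcc_of_le hu1] at ht
    rw [Real.mul_rpow hα.le (hu.trans ht.1)]
    ring
  rw [h3, h2, h1]
  ring

theorem priceCurve_one (hu : 0 < u) (hu1 : u ≤ 1) :
    priceCurve a s u α 1 = a * s * (1 + Real.exp α * priceIntegral s u α 1) := by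
  rw [priceCurve_of_ge hu hu1, mul_one]

theorem isAlphaTwo_iff (ha : 0 < a) (hs : 1 < s) (hu : 0 < u) (hu1 : u ≤ 1) (hα : 0 < α) :
    IsAlphaTwo a s pbar u α ↔ priceCurve a s u α 1 = pbar := by
  have hc : 0 < a * s := by positivity
  have hαs : 0 < α ^ (s - 1) := Real.rpow_pos_of_pos hα _
  have he : Real.exp α ≠ 0 := (Real.exp_pos α).ne'
  have h1 : α ^ (s - 1) / Real.exp (u * α) - pbar * α ^ (s - 1) / (cBar a s * Real.exp α) =
      α ^ (s - 1) * (Real.exp (-(α * u)) - Real.exp (-α) * (pbar / (a * s))) := by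
    rw [Real.exp_neg, Real.exp_neg, cBar, mul_comm u α]
    field_simp
  have h2 : Real.exp (-α) * Real.exp α = 1 := by rw [← Real.exp_add]; simp
  rw [IsAlphaTwo, integral_rpow_mul_exp hs hu.le hu1 hα, h1, mul_right_inj' hαs.ne',
    priceCurve_one hu hu1]
  constructor
  · rintro ⟨-, h⟩
    have h3 : 1 + Real.exp α * priceIntegral s u α 1 = pbar / (a * s) := by
      linear_combination (-Real.exp α) * h + (pbar / (a * s) - 1) * h2
    rw [h3]
    field_simp
  · intro h
    refine ⟨hα, ?_⟩
    have h3 : 1 + Real.exp α * priceIntegral s u α 1 = pbar / (a * s) := by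
      rw [← h]; field_simp
    linear_combination (-Real.exp (-α)) * h3 + priceIntegral s u α 1 * h2

/-- At `u = u_s` the lower limit `uα` is `s` and the factor `α^(s-1)` is `s^s`. -/
theorem cS_eq (hs : 1 < s) : cS a s = priceCurve a s (uS s) (alphaMin s) 1 := by
  have hα : 0 < alphaMin s := Real.rpow_pos_of_pos (by linarith) _
  have h := integral_rpow_mul_exp hs (uS_pos hs).le (uS_lt_one hs).le hα
  rw [mul_comm, alphaMin_mul_uS hs, alphaMin_rpow hs] at h
  have hss : 0 < s ^ s := Real.rpow_pos_of_pos (by linarith) _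
  have h2 : Real.exp (-alphaMin s) * Real.exp (alphaMin s) = 1 := by rw [← Real.exp_add]; simp
  have h3 : 1 / Real.exp s = Real.exp (-s) := by rw [Real.exp_neg, one_div]
  have h4 : ∀ z : ℝ, 1 / s ^ s * (s ^ s * z) = z := by intro z; field_simp
  rw [cS, h, h4, h3, priceCurve_one (uS_pos hs) (uS_lt_one hs).le, cBar]
  linear_combination a * s * h2

theorem cBar_le_cS (ha : 0 < a) (hs : 1 < s) : cBar a s ≤ cS a s := by
  rw [cS_eq hs]
  exact le_priceCurve_of_ge ha hs (uS_pos hs) (Real.rpow_pos_of_pos (by linarith) _)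
    (uS_lt_one hs).le le_rfl

/-- The integrand of the relative markup at the end of the price curve. -/
noncomputable def markupDensity (s α t : ℝ) : ℝ :=
  α * (1 - t ^ (s - 1)) * Real.exp (α * (1 - t))

theorem exp_mul_priceIntegral (s u α : ℝ) :
    Real.exp α * priceIntegral s u α 1 = ∫ t in u..1, markupDensity s α t := by
  rw [priceIntegral, ← intervalIntegral.integral_const_mul]
  refine intervalIntegral.integral_congr fun t _ => ?_
  simp only [markupDensity]
  have : Real.exp (α * (1 - t)) = Real.exp α * Real.exp (-(α * t)) := by
    rw [← Real.exp_add]; ring_nf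
  rw [this]
  ring

theorem continuous_markupDensity (hs : 1 < s) :
    Continuous (Function.uncurry (markupDensity s)) := by
  have : Continuous fun q : ℝ × ℝ => q.2 ^ (s - 1) :=
    continuous_snd.rpow_const fun _ => Or.inr (by linarith)
  unfold markupDensity Function.uncurry
  fun_prop

theorem intervalIntegrable_markupDensity (hs : 1 < s) (α u v : ℝ) :
    IntervalIntegrable (markupDensity s α) MeasureTheory.volume u v :=
  ((continuous_markupDensity hs).comp (continuous_const.prodMk continuous_id)).intervalIntegrable
    u v

theorem markupDensity_pos (hs : 1 < s) (hα : 0 < α) {t : ℝ} (ht : 0 < t) (ht1 : t < 1) :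
    0 < markupDensity s α t := by
  have : t ^ (s - 1) < 1 := Real.rpow_lt_one ht.le ht1 (by linarith)
  exact mul_pos (mul_pos hα (by linarith)) (Real.exp_pos _)

theorem integral_markupDensity_lt (hs : 1 < s) (hα : 0 < α) (hu : 0 < u) (huv : u < v)
    (hv : v ≤ 1) : ∫ t in v..1, markupDensity s α t < ∫ t in u..1, markupDensity s α t := by
  rw [← intervalIntegral.integral_add_adjacent_intervals
    (intervalIntegrable_markupDensity hs α u v) (intervalIntegrable_markupDensity hs α v 1)]
  have := intervalIntegral.intervalIntegral_pos_of_pos_on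
    (intervalIntegrable_markupDensity hs α u v)
    (fun t ht => markupDensity_pos hs hα (hu.trans ht.1) (ht.2.trans_le hv)) huv
  linarith

theorem integral_markupDensity_mono (hs : 1 < s) (hα : 0 ≤ α) {α' : ℝ} (hαα : α ≤ α') (hu : 0 ≤ u)
    (hu1 : u ≤ 1) : ∫ t in u..1, markupDensity s α t ≤ ∫ t in u..1, markupDensity s α' t := by
  refine intervalIntegral.integral_mono_on hu1 (intervalIntegrable_markupDensity hs α u 1)
    (intervalIntegrable_markupDensity hs α' u 1) fun t ht => ?_
  have h1 : t ^ (s - 1) ≤ 1 := Real.rpow_le_one (hu.trans ht.1) ht.2 (by linarith)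
  have h2 : 0 ≤ 1 - t ^ (s - 1) := by linarith
  have h3 : 0 ≤ 1 - t := by linarith [ht.2]
  have h4 : 0 ≤ α' * (1 - t ^ (s - 1)) := mul_nonneg (hα.trans hαα) h2
  unfold markupDensity
  gcongr

theorem priceCurve_one_eq (hu : 0 < u) (hu1 : u ≤ 1) :
    priceCurve a s u α 1 = a * s * (1 + ∫ t in u..1, markupDensity s α t) := by
  rw [priceCurve_one hu hu1, exp_mul_priceIntegral]

/-- The end of the price curve is strictly decreasing in the dividing threshold. -/
theorem priceCurve_one_strictAnti (ha : 0 < a) (hs : 1 < s) (hu : 0 < u) (huv : u < v)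
    (hv : v < 1) :
    priceCurve a s v (alphaOne s v) 1 < priceCurve a s u (alphaOne s u) 1 := by
  have hv0 := hu.trans huv
  rw [priceCurve_one_eq hu (huv.trans hv).le, priceCurve_one_eq hv0 hv.le]
  -- A larger threshold lowers the markup twice: `α` does not increase, and the range of integration
  -- shrinks.
  have h1 := integral_markupDensity_mono hs (alphaOne_pos hs hv0).le
    (alphaOne_antitone hs hu huv.le) hv0.le hv.le
  have h2 := integral_markupDensity_lt hs (alphaOne_pos hs hu) hu huv hv.le
  have hc : 0 < a * s := by positivity
  exact mul_lt_mul_of_pos_left (by linarith) hc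

theorem isCDT_iff (ha : 0 < a) (hs : 1 < s) :
    IsCDT a s pbar u ↔ u ∈ Ioo (0 : ℝ) 1 ∧ priceCurve a s u (alphaOne s u) 1 = pbar := by
  refine and_congr_right fun hu => ?_
  exact isAlphaTwo_iff ha hs hu.1 hu.2.le (alphaOne_pos hs hu.1)

/-- As `u → 0`, `α ≥ (s-1)/u` blows up, and over the fixed interval `[u_s, 1]` the markup is already
at least `α κ`. -/
theorem exists_le_priceCurve_one (ha : 0 < a) (hs : 1 < s) (hp : 0 < pbar) :
    ∃ u, 0 < u ∧ u ≤ uS s ∧ pbar ≤ priceCurve a s u (alphaS s u) 1 := by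
  have hU := uS_pos hs
  have hU1 := uS_lt_one hs
  have hc : 0 < a * s := by positivity
  have hcr : Continuous fun t : ℝ => 1 - t ^ (s - 1) :=
    continuous_const.sub (continuous_id.rpow_const fun _ => Or.inr (by linarith))
  set κ := ∫ t in uS s..1, (1 - t ^ (s - 1)) with hκ
  have hκ0 : 0 < κ := by
    refine intervalIntegral.intervalIntegral_pos_of_pos_on (hcr.intervalIntegrable _ _)
      (fun t ht => ?_) hU1
    have : t ^ (s - 1) < 1 := Real.rpow_lt_one (hU.trans ht.1).le ht.2 (by linarith)
    linarith
  have hs1 : 0 < s - 1 := by linarith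
  set u := min (uS s) (a * s * κ * (s - 1) / pbar) with hu
  have hu0 : 0 < u := lt_min hU (by positivity)
  have huU : u ≤ uS s := min_le_left _ _
  have hu1 : u < 1 := huU.trans_lt hU1
  refine ⟨u, hu0, huU, ?_⟩
  have hα := alphaS_pos hs hu0 hu1
  have h1 : alphaS s u * κ ≤ ∫ t in uS s..1, markupDensity s (alphaS s u) t := by
    rw [hκ, ← intervalIntegral.integral_const_mul]
    refine intervalIntegral.integral_mono_on hU1.le
      ((continuous_const.mul hcr).intervalIntegrable _ _)
      (intervalIntegrable_markupDensity hs _ _ _) fun t ht => ?_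
    have h2 : t ^ (s - 1) ≤ 1 := Real.rpow_le_one (hU.le.trans ht.1) ht.2 (by linarith)
    refine le_mul_of_one_le_right (mul_nonneg hα.le (by linarith)) ?_
    exact Real.one_le_exp (mul_nonneg hα.le (by linarith [ht.2]))
  have h3 : ∫ t in uS s..1, markupDensity s (alphaS s u) t ≤
      ∫ t in u..1, markupDensity s (alphaS s u) t := by
    rcases huU.eq_or_lt with h | h
    · rw [h]
    · exact (integral_markupDensity_lt hs hα hu0 h hU1.le).le
  have h4 : (s - 1) / u ≤ alphaS s u := by
    refine div_le_div_of_nonneg_left hs1.le (sub_rpow_pos hs hu0 hu1) ?_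
    have := Real.rpow_nonneg hu0.le s
    linarith
  have h5 : pbar ≤ a * s * κ * ((s - 1) / u) := by
    have h6 : u ≤ a * s * κ * (s - 1) / pbar := min_le_right _ _
    rw [le_div_iff₀ hp] at h6
    rw [mul_div_assoc', le_div_iff₀ hu0]
    linarith
  rw [priceCurve_one_eq hu0 hu1.le]
  calc pbar ≤ a * s * κ * ((s - 1) / u) := h5
    _ ≤ a * s * κ * alphaS s u := by gcongr
    _ = a * s * (alphaS s u * κ) := by ring
    _ ≤ _ := by
      refine mul_le_mul_of_nonneg_left ?_ hc.le
      linarith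

theorem exists_isCDT (ha : 0 < a) (hs : 1 < s) (hp : cS a s < pbar) :
    ∃ u, IsCDT a s pbar u := by
  have hpos : 0 < pbar := by
    have h1 := cBar_le_cS ha hs
    have h2 : 0 < cBar a s := mul_pos ha (by linarith)
    linarith
  obtain ⟨u₀, hu₀, hu₀U, hle⟩ := exists_le_priceCurve_one ha hs hpos
  have hU1 := uS_lt_one hs
  have hcont : ContinuousOn (fun u => a * s * (1 + ∫ t in u..1, markupDensity s (alphaS s u) t))
      (Icc u₀ (uS s)) := by
    -- Endpoint and parameter vary independently here; the orientation from the fixed endpoint `1`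
    -- costs a sign, undone in `h3`.
    have h1 : Continuous fun q : ℝ × ℝ => ∫ t in (1 : ℝ)..q.1, markupDensity s q.2 t :=
      intervalIntegral.continuous_parametric_intervalIntegral_of_continuous
        (f := fun q : ℝ × ℝ => markupDensity s q.2) ((continuous_markupDensity hs).comp
          (f := fun q : (ℝ × ℝ) × ℝ => (q.1.2, q.2)) (by fun_prop)) continuous_fst
    have h2 : ContinuousOn (fun u => alphaS s u) (Icc u₀ (uS s)) := by
      refine continuousOn_const.div (continuousOn_id.sub
        (continuous_id.rpow_const fun _ => Or.inr (by linarith)).continuousOn) fun u hu => ?_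
      exact (sub_rpow_pos hs (hu₀.trans_le hu.1) (hu.2.trans_lt hU1)).ne'
    have h3 : ContinuousOn (fun u => ∫ t in u..1, markupDensity s (alphaS s u) t)
        (Icc u₀ (uS s)) := by
      refine (h1.comp_continuousOn (continuousOn_id.prodMk h2)).neg.congr fun u _ => ?_
      exact intervalIntegral.integral_symm _ _
    fun_prop
  have hends : pbar ∈ Icc
      (a * s * (1 + ∫ t in uS s..1, markupDensity s (alphaS s (uS s)) t))
      (a * s * (1 + ∫ t in u₀..1, markupDensity s (alphaS s u₀) t)) := by
    rw [← priceCurve_one_eq (uS_pos hs) hU1.le, ← priceCurve_one_eq hu₀ (hu₀U.trans hU1.le),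
      alphaS_uS hs, ← cS_eq hs]
    exact ⟨hp.le, hle⟩
  obtain ⟨u, hu, hup⟩ := intermediate_value_Icc' hu₀U hcont hends
  have hu0 := hu₀.trans_le hu.1
  have hu1 := hu.2.trans_lt hU1
  refine ⟨u, (isCDT_iff ha hs).2 ⟨⟨hu0, hu1⟩, ?_⟩⟩
  rw [alphaOne_of_le hs hu.2, priceCurve_one_eq hu0 hu1.le]
  exact hup

theorem existsUnique_isCDT (ha : 0 < a) (hs : 1 < s) (hp : cS a s < pbar) :
    ∃! u, IsCDT a s pbar u := by
  obtain ⟨u, hu⟩ := exists_isCDT ha hs hp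
  refine ⟨u, hu, fun v hv => ?_⟩
  rw [isCDT_iff ha hs] at hu hv
  rcases lt_trichotomy v u with h | h | h
  · have := priceCurve_one_strictAnti ha hs hv.1.1 h hu.1.2
    rw [hu.2, hv.2] at this
    exact absurd this (lt_irrefl _)
  · exact h
  · have := priceCurve_one_strictAnti ha hs hu.1.1 h hv.1.2
    rw [hu.2, hv.2] at this
    exact absurd this (lt_irrefl _)

theorem IsCDT.lt_uS (ha : 0 < a) (hs : 1 < s) (hp : cS a s < pbar) (h : IsCDT a s pbar u) :
    u < uS s := by
  rw [isCDT_iff ha hs] at h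
  by_contra hcon
  push Not at hcon
  have hU : priceCurve a s (uS s) (alphaOne s (uS s)) 1 = cS a s := by
    rw [alphaOne_of_le hs le_rfl, alphaS_uS hs, cS_eq hs]
  rcases hcon.eq_or_lt with h1 | h1
  · rw [h1, h.2] at hU
    linarith
  · have := priceCurve_one_strictAnti ha hs (uS_pos hs) h1 h.1.2
    rw [h.2, hU] at this
    linarith

end Threshold

/-! ### Assembly of the optimal ratio. -/

section OptimalRatio

open Set Filter Topology

/-- The price curve with dividing threshold `u` is optimal if it ends above `pbar` and no sales
curve beats its ratio. -/
theorem isOptimalCompetitiveRatio_alphaS (K : ℕ) {a s pbar u : ℝ} (ha : 0 < a) (hs : 1 < s)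
    (hp : 0 < pbar) (hu : 0 < u) (hu1 : u < 1) (hend : pbar ≤ priceCurve a s u (alphaS s u) 1)
    (hopt : ∀ β : ℝ, 1 ≤ β → β < alphaS s u →
      ∃ δ : ℝ, 0 < δ ∧ ∀ x Q, ¬ IsSalesCurve (powerCost a s) pbar β δ x Q) :
    IsOptimalCompetitiveRatio K (powerCost a s) pbar (alphaS s u) := by
  have hα := alphaS_pos hs hu hu1
  have hαu := alphaS_mul hs hu hu1
  refine ⟨one_le_alphaS hs hu hu1, fun δ hδ => ?_, fun β hβ hβα => ?_⟩
  · exact achievable_of_priceCurve (powerCost a s) (priceCurve a s u (alphaS s u))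
      (pricePotential a s u (alphaS s u)) pbar (alphaS s u) (one_le_alphaS hs hu hu1)
      (monotoneOn_priceCurve ha hs hu hu1.le hα hαu) (continuous_priceCurve hs hu _ _).continuousOn
      (priceCurve_zero hs hu).ge (pricePotential_zero hs hu)
      (fun x y hx hxy hy => pricePotential_sub_le ha hs hu hu1.le hα hαu hx hxy hy) hend
      (fun y hy z hz => priceCurve_dual_le ha hs hu hα hαu hy hz) δ hδ
  · obtain ⟨δ', hδ', hno⟩ := hopt β hβ hβα
    obtain ⟨δ, hδ, ε, hε, h⟩ := exists_salesCurve (K := K) (powerCost_monotoneOn ha hs)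
      (powerCost_zero hs) hp hβ hδ'
    refine ⟨δ, hδ, ε, hε, fun B hB hB1 hach => ?_⟩
    obtain ⟨x, Q, hxQ⟩ := h B hB hB1 hach
    exact hno x Q hxQ

theorem isOptimalCompetitiveRatio_alphaMin (K : ℕ) {a s pbar : ℝ} (ha : 0 < a) (hs : 1 < s)
    (hp : 0 < pbar) (hpC : pbar ≤ cS a s) :
    IsOptimalCompetitiveRatio K (powerCost a s) pbar (alphaMin s) := by
  have hU := uS_pos hs
  have hU1 := uS_lt_one hs
  rw [← alphaS_uS hs]
  refine isOptimalCompetitiveRatio_alphaS K ha hs hp hU hU1 ?_ fun β hβ hβα => ?_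
  · rwa [alphaS_uS hs, ← cS_eq hs]
  · exact exists_no_salesCurve_of_critical ha hs hU hU1.le (alphaS_pos hs hU hU1)
      (alphaS_mul hs hU hU1) (by rw [alphaS_uS hs, alphaMin_mul_uS hs]) hp hβ hβα

end OptimalRatio

theorem corollary2 (K : ℕ) (hK : 1 ≤ K) (a s pbar : ℝ) (ha : 0 < a) (hs : 1 < s)
    (hp : 0 < pbar) :
    (pbar ≤ cBar a s →
      IsOptimalCompetitiveRatio K (powerCost a s) pbar (s ^ (s / (s - 1)))) ∧
    (cBar a s < pbar → pbar ≤ cS a s →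
      IsOptimalCompetitiveRatio K (powerCost a s) pbar (s ^ (s / (s - 1)))) ∧
    (cS a s < pbar →
      (∃! u : ℝ, IsCDT a s pbar u) ∧
      ∀ u : ℝ, IsCDT a s pbar u →
        u < uS s ∧
        IsOptimalCompetitiveRatio K (powerCost a s) pbar ((s - 1) / (u - u ^ s))) := by
  refine ⟨fun h => isOptimalCompetitiveRatio_alphaMin K ha hs hp (h.trans (cBar_le_cS ha hs)),
    fun _ h => isOptimalCompetitiveRatio_alphaMin K ha hs hp h,
    fun h => ⟨existsUnique_isCDT ha hs h, fun u hu => ?_⟩⟩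
  have huU := hu.lt_uS ha hs h
  obtain ⟨⟨hu0, hu1⟩, hend⟩ := (isCDT_iff ha hs).1 hu
  rw [alphaOne_of_le hs huU.le] at hend
  -- The equality `φ(1) = pbar` serves both ways: `≥` for achievability, `≤` for the lower bound.
  refine ⟨huU, isOptimalCompetitiveRatio_alphaS K ha hs hp hu0 hu1 hend.ge fun β hβ hβα => ?_⟩
  exact exists_no_salesCurve_of_subcritical ha hs hu0 hu1.le (alphaS_pos hs hu0 hu1)
    (alphaS_mul hs hu0 hu1) (alphaS_mul_lt hs hu0 huU) hend.le hβ hβα
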